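/- Let $a,b,c\in\mathbb{C}$ with $c\notin\{0,-1,-2,\dots\}$, and let $F(a,b;c;\omega)=\sum_{n\ge 0}\frac{(a)_n(b)_n}{(c)_n\,n!}\,\omega^n$ ($|\omega|<1$) be the Gaussian hypergeometric function. For $j\ge 0$ put $$d_{2j+1}=\frac{(b+j)(c-a+j)}{(c+2j)(c+2j+1)},\qquad d_{2j+2}=\frac{(a+j+1)(c-b+j+1)}{(c+2j+1)(c+2j+2)},$$ and consider the continued fraction $$\cfrac{1}{1-\cfrac{d_1\omega}{1-\cfrac{d_2\omega}{1-\cfrac{d_3\omega}{1-\cdots}}}} \qquad\Bigl(d_1=\tfrac{b(c-a)}{c(c+1)},\ d_2=\tfrac{(a+1)(c-b+1)}{(c+1)(c+2)},\ d_3=\tfrac{(b+1)(c-a+1)}{(c+2)(c+3)},\dots\Bigr),$$ whose $n$-th approximant $f_n$ is a rational function of $\omega$ (if some $d_m=0$, the continued fraction terminates and $f_n=f_m$ for all $n\ge m$). (i) The continued fraction corresponds to $F(a+1,b;c+1;\omega)/F(a,b;c;\omega)$ at $\omega=0$: the order of vanishing at $0$ of the difference between the power series of this quotient and the Taylor expansion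 of $f_n$ tends to infinity with $n$. (ii) Let $\mathfrak{D}=\{\omega\in\mathbb{C}:|\arg(1-\omega)|<\pi\}=\mathbb{C}\setminus[1,\infty)$. The functions $F(a,b;c;\cdot)$ and $F(a+1,b;c+1;\cdot)$ continue analytically to $\mathfrak{D}$. Let $f=F(a+1,b;c+1;\cdot)/F(a,b;c;\cdot)$ be the quotient of the continuations, a meromorphic function on $\mathfrak{D}$. Then $f_n(\omega)\to f(\omega)$ in the Riemann sphere $\mathbb{C}\cup\{\infty\}$ for every $\omega\in\mathfrak{D}$, and for every compact $K\subset\{\omega\in\mathfrak{D}:f(\omega)\neq\infty\}$ the approximants $f_n$ have no poles in $K$ for all sufficiently large $n$ and converge to $f$ uniformly on $K$. -/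

import Mathlib

open Filter Topology

noncomputable section

namespace GaussCF

/-- The cut plane `{ω : |arg (1 - ω)| < π}`. The argument of `0` is undefined in mathematics but
`0` in Mathlib, so `ω = 1` is excluded explicitly. -/
def cutPlane : Set ℂ :=
  {ω | ω ≠ 1 ∧ |Complex.arg (1 - ω)| < Real.pi}

/-- The coefficients `d_n`, `n ≥ 1`, of the continued fraction:
`d_{2j+1} = (b+j)(c-a+j) / ((c+2j)(c+2j+1))` for `j ≥ 0` and
`d_{2j} = (a+j)(c-b+j) / ((c+2j-1)(c+2j))` for `j ≥ 1`. The entry with index `0` is not used. -/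
def coeff (a b c : ℂ) (n : ℕ) : ℂ :=
  let j : ℂ := ((n / 2 : ℕ) : ℂ)
  if Even n then (a + j) * (c - b + j) / ((c + 2 * j - 1) * (c + 2 * j))
  else (b + j) * (c - a + j) / ((c + 2 * j) * (c + 2 * j + 1))

/-- The continued fraction `1/(1 - d₁ω/(1 - d₂ω/(1 - ⋯)))` over the field `ℂ(ω)` of rational
functions. If some `d_n` is zero, its convergents are constant from some index on, as they
should be for a terminating continued fraction. -/
def contFrac (a b c : ℂ) : GenContFract (RatFunc ℂ) where
  h := 0
  s := Stream'.Seq.ofStream fun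
    | 0 => ⟨1, 1⟩
    | n + 1 => ⟨-(RatFunc.C (coeff a b c (n + 1)) * RatFunc.X), 1⟩

/-- The `n`-th approximant of the continued fraction, a rational function of `ω`. -/
def approximant (a b c : ℂ) (n : ℕ) : RatFunc ℂ :=
  (contFrac a b c).convs n

/-- The hypergeometric series `∑ (a)_n (b)_n / ((c)_n n!) ω ^ n` as a formal power series. -/
def hypSeries (a b c : ℂ) : PowerSeries ℂ :=
  PowerSeries.mk (ordinaryHypergeometricCoefficient a b c)

/-- A sequence of rational functions corresponds (at the origin) to the formal Laurent series `L`
if the order of the difference of `L` and the Laurent expansion of `R n` at `0` tends to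
infinity. -/
def CorrespondsTo (R : ℕ → RatFunc ℂ) (L : LaurentSeries ℂ) : Prop :=
  ∀ m : ℤ, ∀ᶠ n in atTop,
    (m : WithTop ℤ) ≤ (L - (R n : LaurentSeries ℂ)).orderTop

/-- `F` is, on the cut plane, the analytic continuation of the Gaussian hypergeometric function
`F(a, b; c; ·)`, which is given by its power series on the unit disk. -/
def IsHypContinuation (a b c : ℂ) (F : ℂ → ℂ) : Prop :=
  AnalyticOnNhd ℂ F cutPlane ∧
    ∀ ω ∈ Metric.ball (0 : ℂ) 1, F ω = ordinaryHypergeometric a b c ω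

/-- The value of a rational function in the Riemann sphere: `∞` at its poles. -/
def ratValue (R : RatFunc ℂ) (ω : ℂ) : OnePoint ℂ :=
  open Classical in
  if R.denom.eval ω = 0 then OnePoint.infty else ((R.eval (RingHom.id ℂ) ω : ℂ) : OnePoint ℂ)

/-- The value in the Riemann sphere of a meromorphic function in normal form: `∞` at its poles. -/
def meroValue (f : ℂ → ℂ) (ω : ℂ) : OnePoint ℂ :=
  open Classical in
  if meromorphicOrderAt f ω < 0 then OnePoint.infty else ((f ω : ℂ) : OnePoint ℂ)

/-- The quotient `F₁ / F₀` as a meromorphic function on the cut plane, with its removable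
singularities removed. -/
def meroRatio (F₁ F₀ : ℂ → ℂ) : ℂ → ℂ :=
  toMeromorphicNFOn (fun ω => F₁ ω / F₀ ω) cutPlane

end GaussCF

end

noncomputable section

namespace GaussCF

/-! Numerators `A n` and denominators `B n` of the approximants solve `x (n+2) = x (n+1) - d_{n+1} ω
x n`. Gauss's contiguous functions `F_0 = F(a,b;c)`, `F_1 = F(a+1,b;c+1)`, … satisfy the backward
recurrence `F_n = F_{n+1} - d_{n+1} ω F_{n+2}`. Together these give `F_0 A_n - F_1 B_n = -d_1 ⋯ d_n
ω ^ n F_{n+1}` (`mul_recSeq_sub`), and the factor `ω ^ n` is the correspondence at the origin.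

For convergence, `d_n → 1/4`, and `ω = 4r/(1+r)^2` with `|r| < 1` parametrizes the cut plane. The
limiting recurrence has characteristic roots `1/(1+r)` and `r/(1+r)`, of different modulus. Hence on
the image of `|r| < q < 1` a tail of the recurrence, started at a late index `N`, has a zero-free
dominant solution `D` (`norm_dominant_ge`), and by the Casoratian `A_{N+n}/D_n` and `B_{N+n}/D_n`
converge uniformly to holomorphic `P` and `Q` (`exists_uniform_limits`). These have no common zero
if no `d_n` vanishes, because `D` is a combination of `A` and `B` (`limit_ne_zero`).

Near `0` the limit `F_0 P - F_1 Q` is a uniform limit of functions vanishing to order `n`, hence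
zero by Schwarz's lemma, and the identity theorem extends this. So `A_n/B_n` tends to `P/Q =
F_1/F_0` in the sphere. If some `d_m = 0`, the approximants are eventually constant and polynomials
serve as `P` and `Q`.

The continuations come from Euler's integral for `0 < Re b < Re c` and descend to all parameters by
the contiguous relation. -/

/-- The solution of the three-term recurrence `x (n + 2) = x (n + 1) - e (n + 1) * x n` with given
initial values. -/
def recSeq {R : Type*} [CommRing R] (e : ℕ → R) (x₀ x₁ : R) : ℕ → R
  | 0 => x₀
  | 1 => x₁
  | n + 2 => recSeq e x₀ x₁ (n + 1) - e (n + 1) * recSeq e x₀ x₁ n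

/-! ### Three-term recurrences -/

section RecSeq

variable {R S : Type*} [CommRing R] [CommRing S] (e : ℕ → R)

lemma recSeq_add_two (x₀ x₁ : R) (n : ℕ) :
    recSeq e x₀ x₁ (n + 2) = recSeq e x₀ x₁ (n + 1) - e (n + 1) * recSeq e x₀ x₁ n := by
  rw [recSeq]

lemma map_recSeq {e : ℕ → R} {e' : ℕ → S} (f : R →+* S) (he : ∀ k, f (e k) = e' k) (x₀ x₁ : R)
    (n : ℕ) : f (recSeq e x₀ x₁ n) = recSeq e' (f x₀) (f x₁) n := by
  induction n using Nat.twoStepInduction with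
  | zero => simp [recSeq]
  | one => simp [recSeq]
  | more n h₀ h₁ => rw [recSeq_add_two, recSeq_add_two, map_sub, map_mul, h₀, h₁, he]

/-- The Casoratian of two solutions of the recurrence. -/
lemma casoratian {x y : ℕ → R} (hx : ∀ n, x (n + 2) = x (n + 1) - e (n + 1) * x n)
    (hy : ∀ n, y (n + 2) = y (n + 1) - e (n + 1) * y n) (n : ℕ) :
    x (n + 1) * y n - x n * y (n + 1) =
      (∏ i ∈ Finset.range n, e (i + 1)) * (x 1 * y 0 - x 0 * y 1) := by
  induction n with
  | zero => simp
  | succ n ih =>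
    rw [Finset.prod_range_succ, hx, hy]
    linear_combination e (n + 1) * ih

/-- A sequence satisfying the backward recurrence measures the error of the approximants. -/
lemma mul_recSeq_sub {F : ℕ → R} (hF : ∀ n, F n = F (n + 1) - e (n + 1) * F (n + 2)) (n : ℕ) :
    F 0 * recSeq e 0 1 n - F 1 * recSeq e 1 1 n =
      -((∏ i ∈ Finset.range n, e (i + 1)) * F (n + 1)) := by
  induction n using Nat.twoStepInduction with
  | zero => simp [recSeq]
  | one => simp [recSeq, hF 0]
  | more n h₀ h₁ =>
    rw [recSeq_add_two, recSeq_add_two]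
    rw [Finset.prod_range_succ, Finset.prod_range_succ] at *
    linear_combination h₁ - e (n + 1) * h₀ +
      (∏ x ∈ Finset.range n, e (x + 1)) * e (n + 1) * hF (n + 1)

lemma recSeq_ext {x y : ℕ → R} (hx : ∀ n, x (n + 2) = x (n + 1) - e (n + 1) * x n)
    (hy : ∀ n, y (n + 2) = y (n + 1) - e (n + 1) * y n) (h₀ : x 0 = y 0) (h₁ : x 1 = y 1) (n : ℕ) :
    x n = y n := by
  induction n using Nat.twoStepInduction with
  | zero => exact h₀
  | one => exact h₁
  | more n h₀ h₁ => rw [hx, hy, h₀, h₁]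

lemma recSeq_shift (x₀ x₁ : R) (N n : ℕ) :
    recSeq e x₀ x₁ (N + (n + 2)) = recSeq e x₀ x₁ (N + (n + 1)) -
      e (N + (n + 1)) * recSeq e x₀ x₁ (N + n) :=
  recSeq_add_two e x₀ x₁ (N + n)

end RecSeq

/-! ### Gauss's contiguous relations for the coefficients -/

section Contiguous

open scoped Nat

lemma ascPochhammer_eval_ne_zero {c : ℂ} (hc : ∀ n : ℕ, c ≠ -(n : ℂ)) (n : ℕ) :
    (ascPochhammer ℂ n).eval c ≠ 0 := by
  rw [Ne, ascPochhammer_eval_eq_zero_iff]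
  rintro ⟨k, -, hk⟩
  exact hc k (by rw [hk, neg_neg])

lemma ascPochhammer_eval_succ_left (a : ℂ) (n : ℕ) :
    (ascPochhammer ℂ (n + 1)).eval a = a * (ascPochhammer ℂ n).eval (a + 1) := by
  simp [ascPochhammer_succ_left]

lemma add_natCast_ne_neg {c : ℂ} (hc : ∀ n : ℕ, c ≠ -(n : ℂ)) (m : ℕ) (n : ℕ) :
    c + m ≠ -(n : ℂ) := by
  intro h
  refine hc (m + n) ?_
  push_cast
  linear_combination h

lemma add_natCast_ne_zero {c : ℂ} (hc : ∀ n : ℕ, c ≠ -(n : ℂ)) (m : ℕ) : c + m ≠ 0 := by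
  simpa using add_natCast_ne_neg hc m 0

lemma hypCoeff_symm (a b c : ℂ) (n : ℕ) :
    ordinaryHypergeometricCoefficient a b c n = ordinaryHypergeometricCoefficient b a c n := by
  simp only [ordinaryHypergeometricCoefficient]; ring

lemma hypCoeff_zero (a b c : ℂ) : ordinaryHypergeometricCoefficient a b c 0 = 1 := by
  simp [ordinaryHypergeometricCoefficient]

/-- Gauss's contiguous relation between `F(a, b; c)`, `F(a + 1, b; c + 1)` and
`F(a + 1, b + 1; c + 2)`, for the coefficients. -/
lemma hypCoeff_contiguous (a b : ℂ) {c : ℂ} (hc : ∀ n : ℕ, c ≠ -(n : ℂ)) (n : ℕ) :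
    ordinaryHypergeometricCoefficient a b c (n + 1) =
      ordinaryHypergeometricCoefficient (a + 1) b (c + 1) (n + 1) -
        b * (c - a) / (c * (c + 1)) *
          ordinaryHypergeometricCoefficient (a + 1) (b + 1) (c + 2) n := by
  have h0 : c ≠ 0 := by simpa using hc 0
  have h1 : c + 1 ≠ 0 := by simpa using add_natCast_ne_zero hc 1
  have h2 : c + 1 + n ≠ 0 := by
    have := add_natCast_ne_zero hc (1 + n)
    push_cast at this
    rwa [add_assoc]
  have hp : (ascPochhammer ℂ n).eval (c + 2) ≠ 0 :=
    ascPochhammer_eval_ne_zero (by simpa using add_natCast_ne_neg hc 2) n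
  have hc2 : c + 1 + 1 = c + 2 := by ring
  have hf : (n ! : ℂ) ≠ 0 := by exact_mod_cast n.factorial_ne_zero
  have hn : (n : ℂ) + 1 ≠ 0 := by exact_mod_cast n.succ_ne_zero
  -- With every Pochhammer symbol written through `(a+1)_n`, `(b+1)_n` and `(c+2)_n`, the relation
  -- becomes an identity of rational functions.
  have hkey : (ascPochhammer ℂ (n + 1)).eval c =
      c * (c + 1) * (ascPochhammer ℂ n).eval (c + 2) / (c + 1 + n) := by
    rw [eq_div_iff h2, ascPochhammer_eval_succ_left, ← hc2, mul_assoc, mul_assoc,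
      ← ascPochhammer_eval_succ_left, ascPochhammer_succ_eval]
  have hkey' : (ascPochhammer ℂ (n + 1)).eval (c + 1) =
      (c + 1) * (ascPochhammer ℂ n).eval (c + 2) := by
    rw [ascPochhammer_eval_succ_left, hc2]
  simp only [ordinaryHypergeometricCoefficient]
  rw [hkey, hkey', ascPochhammer_eval_succ_left a, ascPochhammer_eval_succ_left b,
    ascPochhammer_succ_eval n (a + 1), Nat.factorial_succ]
  push_cast
  field_simp
  ring

/-- The coefficients of the `n`-th function in Gauss's chain of contiguous functions
`F(a, b; c)`, `F(a + 1, b; c + 1)`, `F(a + 1, b + 1; c + 2)`, … -/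
def chainCoeff (a b c : ℂ) (n : ℕ) : ℕ → ℂ :=
  ordinaryHypergeometricCoefficient (a + ((n + 1) / 2 : ℕ)) (b + (n / 2 : ℕ)) (c + n)

lemma chainCoeff_zero (a b c : ℂ) :
    chainCoeff a b c 0 = ordinaryHypergeometricCoefficient a b c := by
  simp [chainCoeff]

lemma chainCoeff_one (a b c : ℂ) :
    chainCoeff a b c 1 = ordinaryHypergeometricCoefficient (a + 1) b (c + 1) := by
  simp [chainCoeff]

lemma chainCoeff_contiguous (a b : ℂ) {c : ℂ} (hc : ∀ n : ℕ, c ≠ -(n : ℂ)) (n k : ℕ) :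
    chainCoeff a b c n (k + 1) =
      chainCoeff a b c (n + 1) (k + 1) - coeff a b c (n + 1) * chainCoeff a b c (n + 2) k := by
  obtain ⟨j, rfl | rfl⟩ := n.even_or_odd'
  · have e1 : (2 * j + 1) / 2 = j := by omega
    have e2 : 2 * j / 2 = j := by omega
    have e3 : (2 * j + 1 + 1) / 2 = j + 1 := by omega
    have e4 : (2 * j + 2 + 1) / 2 = j + 1 := by omega
    have hodd : ¬ Even (2 * j + 1) := by simp
    simp only [chainCoeff, coeff, e1, e2, e3, e4, if_neg hodd]
    have := hypCoeff_contiguous (a + j) (b + j) (add_natCast_ne_neg hc (2 * j)) k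
    push_cast at this ⊢
    convert this using 2
    · congr 1 <;> ring
    · congr 1
      · congr 1; ring
      · congr 1 <;> ring
  · have e1 : (2 * j + 1) / 2 = j := by omega
    have e3 : (2 * j + 1 + 1) / 2 = j + 1 := by omega
    have e4 : (2 * j + 1 + 1 + 1) / 2 = j + 1 := by omega
    have e6 : (2 * j + 1 + 2 + 1) / 2 = j + 2 := by omega
    have heven : Even (2 * j + 1 + 1) := ⟨j + 1, by ring⟩
    simp only [chainCoeff, coeff, e1, e3, e4, e6, if_pos heven]
    -- From an odd index the next parameter to be raised is `b`, so the relation is used with `a`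
    -- and `b` exchanged.
    have := hypCoeff_contiguous (b + j) (a + (j + 1)) (add_natCast_ne_neg hc (2 * j + 1)) k
    rw [hypCoeff_symm] at this
    rw [hypCoeff_symm (b + j + 1), hypCoeff_symm (b + j + 1)] at this
    push_cast at this ⊢
    convert this using 2
    · congr 1 <;> ring
    · congr 1
      · congr 1 <;> ring
      · congr 1 <;> ring

end Contiguous

/-! ### The approximants as quotients of polynomials -/

/-- Numerators of the approximants. -/
def numPoly (a b c : ℂ) : ℕ → Polynomial ℂ :=
  recSeq (fun n => Polynomial.C (coeff a b c n) * Polynomial.X) 0 1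

/-- Denominators of the approximants. -/
def denPoly (a b c : ℂ) : ℕ → Polynomial ℂ :=
  recSeq (fun n => Polynomial.C (coeff a b c n) * Polynomial.X) 1 1

lemma numPoly_eval (a b c ω : ℂ) (n : ℕ) :
    (numPoly a b c n).eval ω = recSeq (fun n => coeff a b c n * ω) 0 1 n := by
  simpa [numPoly] using map_recSeq (e' := fun n => coeff a b c n * ω) (Polynomial.evalRingHom ω)
    (fun k => by simp) 0 1 n

lemma denPoly_eval (a b c ω : ℂ) (n : ℕ) :
    (denPoly a b c n).eval ω = recSeq (fun n => coeff a b c n * ω) 1 1 n := by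
  simpa [denPoly] using map_recSeq (e' := fun n => coeff a b c n * ω) (Polynomial.evalRingHom ω)
    (fun k => by simp) 1 1 n

lemma recSeq_of_coeff_zero {R : Type*} [CommRing R] {e : ℕ → R} (he : ∀ n, e n = 0) (x : R)
    (n : ℕ) : recSeq e x 1 (n + 1) = 1 := by
  induction n with
  | zero => simp [recSeq]
  | succ n ih => rw [recSeq_add_two, he, ih]; simp

lemma denPoly_eval_zero (a b c : ℂ) (n : ℕ) : (denPoly a b c n).eval 0 = 1 := by
  rw [denPoly_eval]
  cases n with
  | zero => simp [recSeq]
  | succ n => exact recSeq_of_coeff_zero (by simp) _ _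

lemma denPoly_ne_zero (a b c : ℂ) (n : ℕ) : denPoly a b c n ≠ 0 := by
  intro h
  simpa [h] using denPoly_eval_zero a b c n

lemma contFrac_get (a b c : ℂ) (n : ℕ) : (contFrac a b c).s.get? (n + 1) =
    some ⟨-(RatFunc.C (coeff a b c (n + 1)) * RatFunc.X), 1⟩ := rfl

lemma contFrac_nums (a b c : ℂ) (n : ℕ) :
    (contFrac a b c).nums n = algebraMap (Polynomial ℂ) (RatFunc ℂ) (numPoly a b c n) := by
  rw [numPoly, map_recSeq _ fun _ => rfl]
  refine recSeq_ext (fun n => algebraMap (Polynomial ℂ) (RatFunc ℂ)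
    (Polynomial.C (coeff a b c n) * Polynomial.X)) (fun n => ?_) (fun n => recSeq_add_two _ _ _ _)
    ?_ ?_ n
  · rw [GenContFract.nums_recurrence (contFrac_get a b c n) rfl rfl]
    simp
    ring
  · simp [recSeq, contFrac]
  · have : (contFrac a b c).s.get? 0 = some ⟨1, 1⟩ := rfl
    rw [GenContFract.first_num_eq this]
    simp [recSeq, contFrac]

lemma contFrac_dens (a b c : ℂ) (n : ℕ) :
    (contFrac a b c).dens n = algebraMap (Polynomial ℂ) (RatFunc ℂ) (denPoly a b c n) := by
  rw [denPoly, map_recSeq _ fun _ => rfl]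
  refine recSeq_ext (fun n => algebraMap (Polynomial ℂ) (RatFunc ℂ)
    (Polynomial.C (coeff a b c n) * Polynomial.X)) (fun n => ?_) (fun n => recSeq_add_two _ _ _ _)
    ?_ ?_ n
  · rw [GenContFract.dens_recurrence (contFrac_get a b c n) rfl rfl]
    simp
    ring
  · simp [recSeq]
  · have : (contFrac a b c).s.get? 0 = some ⟨1, 1⟩ := rfl
    rw [GenContFract.first_den_eq this]
    simp [recSeq]

lemma approximant_eq (a b c : ℂ) (n : ℕ) : approximant a b c n =
    algebraMap (Polynomial ℂ) (RatFunc ℂ) (numPoly a b c n) /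
      algebraMap (Polynomial ℂ) (RatFunc ℂ) (denPoly a b c n) := by
  rw [approximant, GenContFract.conv_eq_num_div_den, contFrac_nums, contFrac_dens]

/-- `numPoly` and `denPoly` may share a factor, so they need not be the reduced numerator and
denominator; the cross-multiplied form suffices for evaluating. -/
lemma approximant_num_mul (a b c : ℂ) (n : ℕ) :
    (approximant a b c n).num * denPoly a b c n =
      numPoly a b c n * (approximant a b c n).denom := by
  rw [approximant_eq]
  have := RatFunc.num_div_denom (algebraMap (Polynomial ℂ) (RatFunc ℂ) (numPoly a b c n) /
      algebraMap (Polynomial ℂ) (RatFunc ℂ) (denPoly a b c n))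
  have h1 : algebraMap (Polynomial ℂ) (RatFunc ℂ) (denPoly a b c n) ≠ 0 := by
    simpa using denPoly_ne_zero a b c n
  rw [div_eq_div_iff (by simpa using RatFunc.denom_ne_zero _) h1] at this
  apply RatFunc.algebraMap_injective ℂ
  simpa using this

/-! ### Correspondence at the origin -/

/-- The formal power series in Gauss's chain of contiguous functions. -/
def chainSeries (a b c : ℂ) (n : ℕ) : PowerSeries ℂ := PowerSeries.mk (chainCoeff a b c n)

lemma chainSeries_contiguous (a b : ℂ) {c : ℂ} (hc : ∀ n : ℕ, c ≠ -(n : ℂ)) (n : ℕ) :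
    chainSeries a b c n = chainSeries a b c (n + 1) -
      PowerSeries.C (coeff a b c (n + 1)) * PowerSeries.X * chainSeries a b c (n + 2) := by
  ext k
  cases k with
  | zero => simp [chainSeries, chainCoeff, hypCoeff_zero]
  | succ k =>
    rw [map_sub, mul_assoc, PowerSeries.coeff_C_mul, PowerSeries.coeff_succ_X_mul]
    simpa [chainSeries] using chainCoeff_contiguous a b hc n k

lemma hypSeries_mul_sub (a b : ℂ) {c : ℂ} (hc : ∀ n : ℕ, c ≠ -(n : ℂ)) (n : ℕ) :
    hypSeries a b c * (numPoly a b c n : PowerSeries ℂ) -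
      hypSeries (a + 1) b (c + 1) * (denPoly a b c n : PowerSeries ℂ) =
      -((∏ i ∈ Finset.range n, PowerSeries.C (coeff a b c (i + 1)) * PowerSeries.X) *
        chainSeries a b c (n + 1)) := by
  have h := mul_recSeq_sub (fun n => PowerSeries.C (coeff a b c n) * PowerSeries.X)
    (chainSeries_contiguous a b hc) n
  have h0 : chainSeries a b c 0 = hypSeries a b c := by
    rw [chainSeries, chainCoeff_zero, hypSeries]
  have h1 : chainSeries a b c 1 = hypSeries (a + 1) b (c + 1) := by
    rw [chainSeries, chainCoeff_one, hypSeries]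
  rw [← h, h0, h1]
  congr 2
  · simpa [numPoly] using map_recSeq (Polynomial.coeToPowerSeries.ringHom (R := ℂ))
      (fun k => by simp) 0 1 n
  · simpa [denPoly] using map_recSeq (Polynomial.coeToPowerSeries.ringHom (R := ℂ))
      (fun k => by simp) 1 1 n

lemma powerSeries_inv_coe {g : PowerSeries ℂ} (hg : PowerSeries.constantCoeff g ≠ 0) :
    ((g⁻¹ : PowerSeries ℂ) : LaurentSeries ℂ) = (g : LaurentSeries ℂ)⁻¹ := by
  refine eq_inv_of_mul_eq_one_left ?_
  rw [← PowerSeries.coe_mul, PowerSeries.inv_mul_cancel _ hg, PowerSeries.coe_one]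

lemma le_orderTop_coe_X_pow_mul (n : ℕ) (g : PowerSeries ℂ) :
    ((n : ℤ) : WithTop ℤ) ≤
      (((PowerSeries.X ^ n * g : PowerSeries ℂ)) : LaurentSeries ℂ).orderTop := by
  rw [HahnSeries.le_orderTop_iff_forall]
  intro j hj
  have hj' : j < n := by exact_mod_cast hj
  rw [PowerSeries.coeff_coe]
  split_ifs with h
  · rfl
  · rw [PowerSeries.coeff_X_pow_mul', if_neg]
    omega

theorem approximant_correspondsTo (a b : ℂ) {c : ℂ} (hc : ∀ n : ℕ, c ≠ -(n : ℂ)) :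
    CorrespondsTo (approximant a b c)
      ((hypSeries (a + 1) b (c + 1) : LaurentSeries ℂ) / (hypSeries a b c : LaurentSeries ℂ)) := by
  intro m
  filter_upwards [eventually_ge_atTop m.toNat] with n hn
  have hmn : (m : WithTop ℤ) ≤ ((n : ℤ) : WithTop ℤ) := by
    have : m ≤ n := by omega
    exact_mod_cast this
  refine hmn.trans ?_
  have hF : PowerSeries.constantCoeff (hypSeries a b c) = 1 := by
    rw [← PowerSeries.coeff_zero_eq_constantCoeff_apply]
    simp [hypSeries, hypCoeff_zero]
  have hB : PowerSeries.constantCoeff (denPoly a b c n : PowerSeries ℂ) = 1 := by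
    have := denPoly_eval_zero a b c n
    rw [← Polynomial.coeff_zero_eq_eval_zero] at this
    rw [← PowerSeries.coeff_zero_eq_constantCoeff_apply]
    simpa using this
  have hF0 : (hypSeries a b c : LaurentSeries ℂ) ≠ 0 := by
    intro h
    rw [← PowerSeries.coe_zero] at h
    have := HahnSeries.ofPowerSeries_injective h
    simp [this] at hF
  have hB0 : ((denPoly a b c n : PowerSeries ℂ) : LaurentSeries ℂ) ≠ 0 := by
    intro h
    rw [← PowerSeries.coe_zero] at h
    have := HahnSeries.ofPowerSeries_injective h
    simp [this] at hB
  have hR : (approximant a b c n : LaurentSeries ℂ) =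
      ((numPoly a b c n : PowerSeries ℂ) : LaurentSeries ℂ) /
        ((denPoly a b c n : PowerSeries ℂ) : LaurentSeries ℂ) := by
    rw [approximant_eq, map_div₀, RatFunc.coe_coe, RatFunc.coe_coe]
    rfl
  -- Both denominators have constant term `1`, so their inverses are power series and the factor `X
  -- ^ n` bounds the order.
  have key : (hypSeries (a + 1) b (c + 1) : LaurentSeries ℂ) / (hypSeries a b c : LaurentSeries ℂ) -
      (approximant a b c n : LaurentSeries ℂ) =
      ((PowerSeries.X ^ n * (PowerSeries.C (∏ i ∈ Finset.range n, coeff a b c (i + 1)) *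
        chainSeries a b c (n + 1) * (hypSeries a b c)⁻¹ *
          (denPoly a b c n : PowerSeries ℂ)⁻¹) : PowerSeries ℂ) : LaurentSeries ℂ) := by
    have h := hypSeries_mul_sub a b hc n
    rw [Finset.prod_mul_distrib, Finset.prod_const, Finset.card_range, ← map_prod] at h
    have h' := congrArg (HahnSeries.ofPowerSeries ℤ ℂ) h
    simp only [map_sub, map_mul, map_neg] at h'
    simp only [PowerSeries.coe_mul]
    rw [powerSeries_inv_coe (by simp [hF]), powerSeries_inv_coe (by simp [hB]), hR]
    field_simp
    linear_combination -h'
  rw [key]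
  exact le_orderTop_coe_X_pow_mul _ _

/-! ### Dominant solutions and geometric convergence -/

section Growth

/-- The dominant solution of a perturbed recurrence with characteristic roots `1` and `r`. -/
lemma norm_dominant_ge {r : ℂ} {q : ℝ} (hr : ‖r‖ ≤ q) (hq1 : q < 1) {η : ℕ → ℂ}
    (hη : ∀ k, ‖η k‖ ≤ (1 - q) ^ 2 / 8) {y : ℕ → ℂ} (h0 : y 0 = 1) (h1 : y 1 = 1 + r)
    (hy : ∀ k, y (k + 2) = (1 + r) * y (k + 1) - r * (1 + η k) * y k) (k : ℕ) :
    (1 - q) / 2 * ((3 + q) / 4) ^ k ≤ ‖y k‖ := by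
  have hq0 : 0 ≤ q := (norm_nonneg r).trans hr
  have h1r : 1 - q ≤ ‖1 - r‖ := by
    have := norm_sub_norm_le 1 r
    rw [norm_one] at this
    linarith
  have h1r' : ‖1 - r‖ ≤ 2 := by
    have := norm_sub_le 1 r
    rw [norm_one] at this
    linarith
  -- `y (k+1) - r * y k` and `y (k+1) - y k` are the components along the roots `1` and `r`. The
  -- perturbation couples them, but the first keeps dominating the second and shrinks at most by
  -- `(3+q)/4` per step.
  have main : ∀ k, ‖y (k + 1) - y k‖ ≤ ‖y (k + 1) - r * y k‖ ∧
      ((3 + q) / 4) ^ k ≤ ‖y (k + 1) - r * y k‖ := by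
    intro k
    induction k with
    | zero =>
      rw [zero_add, h0, h1]
      have e1 : (1 : ℂ) + r - 1 = r := by ring
      have e2 : (1 : ℂ) + r - r * 1 = 1 := by ring
      rw [e1, e2]
      simp
      linarith
    | succ k ih =>
      obtain ⟨ih1, ih2⟩ := ih
      set u := y (k + 1) - r * y k with hu
      set v := y (k + 1) - y k with hv
      have eu : y (k + 2) - r * y (k + 1) = u - r * η k * y k := by rw [hy, hu]; ring
      have ev : y (k + 2) - y (k + 1) = r * v - r * η k * y k := by rw [hy, hv]; ring
      have ey : (1 - r) * y k = u - v := by rw [hu, hv]; ring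
      have hyk : (1 - q) * ‖y k‖ ≤ 2 * ‖u‖ := by
        have : ‖(1 - r) * y k‖ ≤ ‖u‖ + ‖v‖ := by rw [ey]; exact norm_sub_le _ _
        rw [norm_mul] at this
        have := mul_le_mul_of_nonneg_right h1r (norm_nonneg (y k))
        linarith
      -- The bound `(1-q)^2/8` on `η` is chosen for this: one factor `1-q` pays for recovering `y k`
      -- from the components, the other leaves `1 - (1-q)/4 = (3+q)/4`.
      have herr : ‖r * η k * y k‖ ≤ (1 - q) / 4 * ‖u‖ := by
        rw [norm_mul, norm_mul]
        calc ‖r‖ * ‖η k‖ * ‖y k‖ ≤ 1 * ((1 - q) ^ 2 / 8) * ‖y k‖ := by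
              gcongr
              · linarith
              · exact hη k
          _ = (1 - q) / 8 * ((1 - q) * ‖y k‖) := by ring
          _ ≤ (1 - q) / 8 * (2 * ‖u‖) := by
              apply mul_le_mul_of_nonneg_left hyk; linarith
          _ = (1 - q) / 4 * ‖u‖ := by ring
      have hu' : (3 + q) / 4 * ‖u‖ ≤ ‖y (k + 1 + 1) - r * y (k + 1)‖ := by
        have := norm_sub_norm_le u (r * η k * y k)
        rw [← eu] at this
        change _ ≤ ‖y (k + 2) - r * y (k + 1)‖
        linarith
      refine ⟨le_trans ?_ hu', le_trans ?_ hu'⟩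
      · change ‖y (k + 2) - y (k + 1)‖ ≤ _
        rw [ev]
        have h2 : ‖r * v‖ ≤ q * ‖u‖ := by
          rw [norm_mul]; gcongr
        have := norm_sub_le (r * v) (r * η k * y k)
        nlinarith [norm_nonneg u]
      · rw [pow_succ, mul_comm]
        gcongr
  cases k with
  | zero => rw [h0]; simp; linarith
  | succ k =>
    obtain ⟨m1, m2⟩ := main k
    set u := y (k + 1) - r * y k with hu
    set v := y (k + 1) - y k with hv
    have ey : (1 - r) * y (k + 1) = u - r * v := by rw [hu, hv]; ring
    have h3 : (1 - q) * ‖u‖ ≤ 2 * ‖y (k + 1)‖ := by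
      have h4 := norm_sub_norm_le u (r * v)
      rw [← ey, norm_mul, norm_mul] at h4
      have h5 : ‖r‖ * ‖v‖ ≤ q * ‖u‖ := by gcongr
      have h6 := mul_le_mul_of_nonneg_right h1r' (norm_nonneg (y (k + 1)))
      linarith
    have h7 : ((3 + q) / 4) ^ (k + 1) ≤ ‖u‖ := by
      refine le_trans ?_ m2
      exact pow_le_pow_of_le_one (by linarith) (by linarith) (Nat.le_succ k)
    have h8 : (1 - q) / 2 * ((3 + q) / 4) ^ (k + 1) ≤ (1 - q) / 2 * ‖u‖ :=
      mul_le_mul_of_nonneg_left h7 (by linarith)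
    linarith

/-- Consecutive ratios of an arbitrary solution and the dominant solution differ by a
geometrically small amount. -/
lemma ratio_diff_le {r : ℂ} {q : ℝ} (hr : ‖r‖ ≤ q) (hq1 : q < 1) {e : ℕ → ℂ}
    (he : ∀ k, ‖e k * (1 + r) ^ 2 - r‖ ≤ ‖r‖ * ((1 - q) ^ 2 / 8))
    {x : ℕ → ℂ} (hx : ∀ n, x (n + 2) = x (n + 1) - e (n + 1) * x n) (k : ℕ) :
    recSeq e 1 1 k ≠ 0 ∧
    ‖x (k + 1) / recSeq e 1 1 (k + 1) - x k / recSeq e 1 1 k‖ ≤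
      ‖x 1 - x 0‖ * (16 / (1 - q) ^ 2) *
        (q * (1 + (1 - q) ^ 2 / 8) / ((3 + q) / 4) ^ 2) ^ k := by
  have hq0 : 0 ≤ q := (norm_nonneg r).trans hr
  have hq : 0 < 1 - q := by linarith
  have h1r : 1 + r ≠ 0 := by
    intro h
    have : r = -1 := by linear_combination h
    rw [this, norm_neg, norm_one] at hr
    linarith
  set D := recSeq e 1 1 with hD
  have hDrec : ∀ n, D (n + 2) = D (n + 1) - e (n + 1) * D n := recSeq_add_two e 1 1
  obtain ⟨η, hη⟩ : ∃ η : ℕ → ℂ, ∀ k, e (k + 1) * (1 + r) ^ 2 = r * (1 + η k) ∧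
      ‖η k‖ ≤ (1 - q) ^ 2 / 8 := by
    -- For `r = 0` the hypothesis forces `e = 0`, and division by zero gives `η = 0`, as needed.
    refine ⟨fun k => (e (k + 1) * (1 + r) ^ 2 - r) / r, fun k => ?_⟩
    by_cases hr0 : r = 0
    · have := he (k + 1)
      simp only [hr0, norm_zero, zero_mul, norm_le_zero_iff] at this
      simp only [hr0]
      constructor
      · linear_combination this
      · simp; positivity
    · constructor
      · field_simp; ring
      · rw [norm_div, div_le_iff₀ (norm_pos_iff.2 hr0), mul_comm _ ‖r‖]
        exact he (k + 1)
  -- Scaling by `(1+r)^k` normalizes the characteristic roots to `1` and `r`.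
  have hy := fun k => norm_dominant_ge hr hq1 (η := η) (fun k => (hη k).2)
    (y := fun k => (1 + r) ^ k * D k) (by simp [hD, recSeq]) (by simp [hD, recSeq])
    (fun k => by
      simp only [hDrec]
      linear_combination -(1 + r) ^ k * D k * (hη k).1) k
  set s := (3 + q) / 4 with hs
  have hs0 : 0 < s := by rw [hs]; linarith
  have hpos : ∀ k, 0 < (1 - q) / 2 * s ^ k := fun k => by positivity
  have hDne : ∀ k, D k ≠ 0 := by
    intro k h
    have h1 := hy k
    have h2 := hpos k
    simp only [h, mul_zero, norm_zero] at h1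
    linarith
  refine ⟨hDne k, ?_⟩
  -- The difference of consecutive ratios is a Casoratian, a product of about `r ^ k` after scaling,
  -- over two values of the dominant solution.
  have hdiff : x (k + 1) / D (k + 1) - x k / D k =
      (∏ i ∈ Finset.range k, e (i + 1)) * (x 1 - x 0) / (D k * D (k + 1)) := by
    rw [div_sub_div _ _ (hDne _) (hDne _)]
    have hc := casoratian e hx hDrec k
    have : D 0 = 1 ∧ D 1 = 1 := by simp [hD, recSeq]
    rw [this.1, this.2, mul_one, mul_one] at hc
    rw [← hc]
    congr 1 <;> ring
  have hmul : x (k + 1) / D (k + 1) - x k / D k =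
      (∏ i ∈ Finset.range k, r * (1 + η i)) * (x 1 - x 0) * (1 + r) /
        (((1 + r) ^ k * D k) * ((1 + r) ^ (k + 1) * D (k + 1))) := by
    have hp : ∏ i ∈ Finset.range k, r * (1 + η i) =
        (∏ i ∈ Finset.range k, e (i + 1)) * ((1 + r) ^ 2) ^ k := by
      rw [← Finset.prod_congr rfl fun i _ => (hη i).1, Finset.prod_mul_distrib]
      simp
    rw [hdiff, hp, div_eq_div_iff (mul_ne_zero (hDne _) (hDne _))
      (mul_ne_zero (mul_ne_zero (pow_ne_zero _ h1r) (hDne _))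
        (mul_ne_zero (pow_ne_zero _ h1r) (hDne _))), ← pow_mul]
    ring
  rw [hmul, norm_div, norm_mul, norm_mul, norm_mul, norm_prod]
  have hp : ∏ i ∈ Finset.range k, ‖r * (1 + η i)‖ ≤ (q * (1 + (1 - q) ^ 2 / 8)) ^ k := by
    rw [← Finset.card_range k, ← Finset.prod_const, Finset.card_range]
    refine Finset.prod_le_prod (fun _ _ => norm_nonneg _) fun i _ => ?_
    rw [norm_mul]
    gcongr
    refine (norm_add_le _ _).trans ?_
    rw [norm_one]
    gcongr
    exact (hη i).2
  have h1r2 : ‖1 + r‖ ≤ 2 := by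
    have := norm_add_le 1 r
    rw [norm_one] at this
    linarith
  have hs1 : 1 / 2 ≤ s := by rw [hs]; linarith
  calc _ ≤ (q * (1 + (1 - q) ^ 2 / 8)) ^ k * ‖x 1 - x 0‖ * 2 /
        (((1 - q) / 2 * s ^ k) * ((1 - q) / 2 * s ^ (k + 1))) := by
        gcongr
        · exact hy k
        · exact hy (k + 1)
    _ = ‖x 1 - x 0‖ * (8 / s / (1 - q) ^ 2) * (q * (1 + (1 - q) ^ 2 / 8) / s ^ 2) ^ k := by
        generalize q * (1 + (1 - q) ^ 2 / 8) = M
        clear_value s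
        rw [div_pow, ← pow_mul, pow_succ, pow_mul']
        field_simp
        ring
    _ ≤ _ := by
        gcongr
        rw [div_le_iff₀ hs0]
        linarith

/-- With `t = 1 - q`, the denominator minus the numerator is `t/2 - t^2/16 + t^3/8`, which is
positive for `0 < t ≤ 1`. -/
lemma ratio_lt_one {q : ℝ} (hq0 : 0 ≤ q) (hq1 : q < 1) :
    q * (1 + (1 - q) ^ 2 / 8) / ((3 + q) / 4) ^ 2 < 1 := by
  rw [div_lt_one (by positivity)]
  nlinarith [mul_nonneg hq0 (sub_nonneg.2 hq1.le), mul_pos (sub_pos.2 hq1) (sub_pos.2 hq1),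
    mul_nonneg (mul_nonneg hq0 (sub_nonneg.2 hq1.le)) (sub_nonneg.2 hq1.le)]

lemma exists_tendstoUniformlyOn_of_summable {α : Type*} {f : ℕ → α → ℂ} {u : ℕ → ℝ} {s : Set α}
    (hu : Summable u) (h : ∀ n, ∀ x ∈ s, ‖f (n + 1) x - f n x‖ ≤ u n) :
    ∃ g, TendstoUniformlyOn f g atTop s := by
  have := tendstoUniformlyOn_tsum_nat hu (s := s) (f := fun n x => f (n + 1) x - f n x) h
  refine ⟨fun x => ∑' n, (f (n + 1) x - f n x) + f 0 x, ?_⟩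
  rw [Metric.tendstoUniformlyOn_iff] at this ⊢
  intro ε hε
  filter_upwards [this ε hε] with n hn x hx
  have := hn x hx
  rw [Finset.sum_range_sub (fun n => f n x)] at this
  rw [dist_eq_norm] at this ⊢
  convert this using 2
  ring

end Growth

/-! ### The cut plane as the image of the unit disk -/

section Domain

lemma mem_cutPlane_iff {ω : ℂ} : ω ∈ cutPlane ↔ 1 - ω ∈ Complex.slitPlane := by
  rw [Complex.mem_slitPlane_iff_arg, cutPlane, Set.mem_ofPred_eq, sub_ne_zero, and_comm, ne_comm,
    abs_lt]
  refine and_congr_left fun _ => ⟨fun h => h.2.ne, fun h => ?_⟩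
  exact ⟨Complex.neg_pi_lt_arg _, lt_of_le_of_ne (Complex.arg_le_pi _) h⟩

lemma isOpen_cutPlane : IsOpen cutPlane := by
  have : cutPlane = (fun ω : ℂ => 1 - ω) ⁻¹' Complex.slitPlane := by
    ext ω; exact mem_cutPlane_iff
  rw [this]
  exact Complex.isOpen_slitPlane.preimage (by fun_prop)

lemma ball_subset_cutPlane : Metric.ball (0 : ℂ) 1 ⊆ cutPlane := by
  intro ω hω
  rw [mem_cutPlane_iff]
  left
  have h1 := Complex.re_le_norm ω
  have h2 : ‖ω‖ < 1 := by simpa using hω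
  simp only [Complex.sub_re, Complex.one_re]
  linarith

/-- The map `r ↦ 4 r / (1 + r) ^ 2`, which takes the unit disk onto the cut plane. -/
def cutMap (r : ℂ) : ℂ := 4 * r / (1 + r) ^ 2

lemma one_add_ne_zero {r : ℂ} (hr : ‖r‖ < 1) : 1 + r ≠ 0 := by
  intro h
  have : r = -1 := by linear_combination h
  rw [this, norm_neg, norm_one] at hr
  exact lt_irrefl _ hr

lemma cutMap_mem_cutPlane {r : ℂ} (hr : ‖r‖ < 1) : cutMap r ∈ cutPlane := by
  have h1 := one_add_ne_zero hr
  rw [mem_cutPlane_iff]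
  -- The Cayley transform maps the disk to the right half-plane, and squaring maps that to the slit
  -- plane.
  have e : 1 - cutMap r = ((1 - r) / (1 + r)) ^ 2 := by
    rw [cutMap]; field_simp; ring
  have hre : 0 < ((1 - r) / (1 + r)).re := by
    have hn : 0 < Complex.normSq (1 + r) := Complex.normSq_pos.2 h1
    rw [Complex.div_re, ← add_div]
    refine div_pos ?_ hn
    have h2 : Complex.normSq r < 1 := by
      rw [Complex.normSq_eq_norm_sq]
      nlinarith [norm_nonneg r]
    rw [Complex.normSq_apply] at h2
    simp
    nlinarith
  rw [e, Complex.mem_slitPlane_iff]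
  set z := (1 - r) / (1 + r)
  by_cases him : z.im = 0
  · left
    rw [sq, Complex.mul_re, him]
    nlinarith
  · right
    rw [sq, Complex.mul_im]
    intro h
    have : z.re * z.im = 0 := by linarith
    rcases mul_eq_zero.1 this with h | h
    · exact hre.ne' h
    · exact him h

lemma exists_cutMap_eq {ω : ℂ} (hω : ω ∈ cutPlane) : ∃ r : ℂ, ‖r‖ < 1 ∧ cutMap r = ω := by
  rw [mem_cutPlane_iff] at hω
  obtain ⟨s, hs, hre⟩ : ∃ s : ℂ, s ^ 2 = 1 - ω ∧ 0 < s.re := by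
    refine ⟨(1 - ω) ^ (1 / 2 : ℂ), ?_, ?_⟩
    · rw [← Complex.cpow_nat_mul]; norm_num
    · have harg := Complex.mem_slitPlane_iff_arg.1 hω
      rw [Complex.cpow_def_of_ne_zero harg.2, Complex.exp_re]
      refine mul_pos (Real.exp_pos _) (Real.cos_pos_of_mem_Ioo ?_)
      have h1 := Complex.neg_pi_lt_arg (1 - ω)
      have h2 := lt_of_le_of_ne (Complex.arg_le_pi (1 - ω)) harg.1
      have h3 : (Complex.log (1 - ω) * (1 / 2)).im = Complex.arg (1 - ω) / 2 := by
        have : Complex.log (1 - ω) * (1 / 2) = Complex.log (1 - ω) / (2 : ℝ) := by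
          push_cast; ring
        rw [this, Complex.div_ofReal_im, Complex.log_im]
      rw [h3]
      constructor <;> linarith
  have hs1 : 1 + s ≠ 0 := by
    intro h
    have := congrArg Complex.re h
    simp at this
    linarith
  -- The inverse Cayley transform of the square root of `1 - ω` with positive real part.
  refine ⟨(1 - s) / (1 + s), ?_, ?_⟩
  · rw [norm_div, div_lt_one (norm_pos_iff.2 hs1), ← sq_lt_sq₀ (norm_nonneg _) (norm_nonneg _),
      ← Complex.normSq_eq_norm_sq, ← Complex.normSq_eq_norm_sq, Complex.normSq_apply,
      Complex.normSq_apply]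
    simp
    nlinarith
  · have e : 1 + (1 - s) / (1 + s) = 2 / (1 + s) := by field_simp; ring
    rw [cutMap, e]
    field_simp
    linear_combination -4 * hs

/-- The image of the disk of radius `q` under `cutMap`. For `q < 1` these domains exhaust the cut
plane. -/
def cutDisk (q : ℝ) : Set ℂ := cutMap '' Metric.ball 0 q

lemma zero_mem_cutDisk {q : ℝ} (hq0 : 0 < q) : (0 : ℂ) ∈ cutDisk q :=
  ⟨0, by simpa using hq0, by simp [cutMap]⟩

lemma cutDisk_subset_cutPlane {q : ℝ} (hq1 : q ≤ 1) : cutDisk q ⊆ cutPlane := by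
  rintro _ ⟨r, hr, rfl⟩
  refine cutMap_mem_cutPlane (lt_of_lt_of_le ?_ hq1)
  simpa using hr

lemma differentiableOn_cutMap : DifferentiableOn ℂ cutMap (Metric.ball 0 1) := by
  intro r hr
  have : (1 + r) ^ 2 ≠ 0 := pow_ne_zero _ (one_add_ne_zero (by simpa using hr))
  have h : DifferentiableAt ℂ (fun r : ℂ => 4 * r / (1 + r) ^ 2) r :=
    DifferentiableAt.fun_div (by fun_prop) (by fun_prop) this
  exact h.differentiableWithinAt

lemma isPreconnected_cutDisk {q : ℝ} (hq1 : q ≤ 1) : IsPreconnected (cutDisk q) :=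
  (convex_ball (0 : ℂ) q).isPreconnected.image _
    (differentiableOn_cutMap.continuousOn.mono (Metric.ball_subset_ball hq1))

lemma isOpen_cutDisk {q : ℝ} (hq1 : q ≤ 1) : IsOpen (cutDisk q) := by
  have han : AnalyticOnNhd ℂ cutMap (Metric.ball 0 1) :=
    differentiableOn_cutMap.analyticOnNhd Metric.isOpen_ball
  -- Open mapping theorem; the values at `0` and `1/2` exclude a constant.
  rcases han.is_constant_or_isOpen (convex_ball (0 : ℂ) 1).isPreconnected with ⟨w, hw⟩ | h
  · have h0 := hw 0 (by simp)
    have h1 := hw (1 / 2) (by simp; norm_num)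
    rw [← h0] at h1
    norm_num [cutMap] at h1
  · exact h _ (Metric.ball_subset_ball hq1) Metric.isOpen_ball

lemma exists_subset_cutDisk {K : Set ℂ} (hK : IsCompact K) (hKc : K ⊆ cutPlane) :
    ∃ q : ℝ, 0 < q ∧ q < 1 ∧ K ⊆ cutDisk q := by
  have hd : Directed (· ⊆ ·) fun q : Set.Ioo (0 : ℝ) 1 => cutDisk q := by
    have : Monotone fun q : Set.Ioo (0 : ℝ) 1 => cutDisk q := fun p q hpq =>
      Set.image_mono (Metric.ball_subset_ball hpq)
    exact this.directed_le
  have : Nonempty (Set.Ioo (0 : ℝ) 1) := ⟨⟨1 / 2, by norm_num⟩⟩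
  obtain ⟨q, hq⟩ := hK.elim_directed_cover (fun q : Set.Ioo (0 : ℝ) 1 => cutDisk q)
    (fun q => isOpen_cutDisk q.2.2.le) (fun ω hω => by
      obtain ⟨r, hr, rfl⟩ := exists_cutMap_eq (hKc hω)
      rw [Set.mem_iUnion]
      have := norm_nonneg r
      exact ⟨⟨(‖r‖ + 1) / 2, by constructor <;> linarith⟩, r, by simp; linarith, rfl⟩) hd
  exact ⟨q, q.2.1, q.2.2, hq⟩

/-- Boundedness gives a uniform bound for the starting values of the tail, which are polynomials in
`ω`. -/
lemma cutDisk_subset_closedBall {q : ℝ} (hq1 : q < 1) :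
    cutDisk q ⊆ Metric.closedBall 0 (4 / (1 - q) ^ 2) := by
  rintro _ ⟨r, hr, rfl⟩
  have hr' : ‖r‖ < q := by simpa using hr
  have h1 : 1 - q ≤ ‖1 + r‖ := by
    have := norm_sub_norm_le 1 (-r)
    rw [norm_one, norm_neg, sub_neg_eq_add] at this
    linarith
  have hq : 0 < 1 - q := by linarith
  simp only [cutMap, mem_closedBall_zero_iff, norm_div, norm_mul, norm_pow, Complex.norm_ofNat]
  gcongr
  linarith

end Domain

/-! ### Uniform limits of scaled numerators and denominators -/

section Limits

lemma differentiable_recSeq (d : ℕ → ℂ) (x₀ x₁ : ℂ) (n : ℕ) :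
    Differentiable ℂ fun ω => recSeq (fun k => d k * ω) x₀ x₁ n := by
  induction n using Nat.twoStepInduction with
  | zero => simp [recSeq]
  | one => simp [recSeq]
  | more n h₀ h₁ => simp only [recSeq_add_two]; fun_prop

/-- Solutions of the recurrence, divided by the dominant solution of a tail, converge uniformly. -/
lemma exists_uniform_limits {d : ℕ → ℂ} (hd : Tendsto d atTop (𝓝 (1 / 4))) {q : ℝ} (hq0 : 0 < q)
    (hq1 : q < 1) :
    ∃ N, (∀ n, ∀ ω ∈ cutDisk q, recSeq (fun k => d (N + k) * ω) 1 1 n ≠ 0) ∧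
      ∀ x₀ x₁ : ℂ, ∃ P, TendstoUniformlyOn
        (fun n ω => recSeq (fun k => d k * ω) x₀ x₁ (N + n) /
          recSeq (fun k => d (N + k) * ω) 1 1 n) P atTop (cutDisk q) := by
  have hpos : 0 < (1 - q) ^ 2 / 8 := by
    have : 0 < 1 - q := by linarith
    positivity
  obtain ⟨N, hN⟩ : ∃ N, ∀ n ≥ N, ‖4 * d n - 1‖ ≤ (1 - q) ^ 2 / 8 := by
    have h : Tendsto (fun n => ‖4 * d n - 1‖) atTop (𝓝 0) := by
      have := ((hd.const_mul 4).sub_const 1).norm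
      norm_num at this
      exact this
    exact eventually_atTop.1 (h.eventually_le_const hpos)
  have key : ∀ r : ℂ, ‖r‖ < q → ∀ k,
      ‖d (N + k) * cutMap r * (1 + r) ^ 2 - r‖ ≤ ‖r‖ * ((1 - q) ^ 2 / 8) := by
    intro r hr k
    have h1 := one_add_ne_zero (hr.trans hq1)
    -- The parametrization turns the distance of `d` from `1/4` into a relative perturbation of the
    -- root `r`.
    have e : d (N + k) * cutMap r * (1 + r) ^ 2 - r = r * (4 * d (N + k) - 1) := by
      rw [cutMap]; field_simp
    rw [e, norm_mul]
    gcongr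
    exact hN _ (Nat.le_add_right _ _)
  refine ⟨N, ?_, fun x₀ x₁ => ?_⟩
  · rintro n _ ⟨r, hr, rfl⟩
    have hr' : ‖r‖ < q := by simpa using hr
    exact (ratio_diff_le hr'.le hq1 (key r hr')
      (recSeq_add_two (fun k => d (N + k) * cutMap r) 1 1) n).1
  · have hcont : Continuous fun ω : ℂ => recSeq (fun k => d k * ω) x₀ x₁ (N + 1) -
        recSeq (fun k => d k * ω) x₀ x₁ (N + 0) :=
      ((differentiable_recSeq d x₀ x₁ _).sub (differentiable_recSeq d x₀ x₁ _)).continuous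
    obtain ⟨M, hM⟩ := (isCompact_closedBall (0 : ℂ) (4 / (1 - q) ^ 2)).exists_bound_of_continuousOn
      hcont.continuousOn
    refine exists_tendstoUniformlyOn_of_summable (u := fun k => M * (16 / (1 - q) ^ 2) *
        (q * (1 + (1 - q) ^ 2 / 8) / ((3 + q) / 4) ^ 2) ^ k) ?_ ?_
    · exact (summable_geometric_of_lt_one (by positivity) (ratio_lt_one hq0.le hq1)).mul_left _
    · rintro n ω hω
      have hM' := hM ω (cutDisk_subset_closedBall hq1 hω)
      obtain ⟨r, hr, rfl⟩ := hω
      have hr' : ‖r‖ < q := by simpa using hr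
      refine (ratio_diff_le hr'.le hq1 (key r hr')
        (x := fun n => recSeq (fun k => d k * cutMap r) x₀ x₁ (N + n))
        (recSeq_shift _ x₀ x₁ N) n).2.trans ?_
      gcongr

/-- For `ω ≠ 0` the Casoratian of numerators and denominators at `N` is nonzero, so `D` is a fixed
combination of them. Dividing by `D` and passing to the limit writes `1` as a combination of `P` and
`Q`. At `ω = 0` the limit `Q` is `1`. -/
lemma limit_ne_zero {d : ℕ → ℂ} (hd0 : ∀ n, d (n + 1) ≠ 0) (N : ℕ) {ω P Q : ℂ}
    (hD : ∀ n, recSeq (fun k => d (N + k) * ω) 1 1 n ≠ 0)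
    (hP : Tendsto (fun n => recSeq (fun k => d k * ω) 0 1 (N + n) /
      recSeq (fun k => d (N + k) * ω) 1 1 n) atTop (𝓝 P))
    (hQ : Tendsto (fun n => recSeq (fun k => d k * ω) 1 1 (N + n) /
      recSeq (fun k => d (N + k) * ω) 1 1 n) atTop (𝓝 Q)) :
    P ≠ 0 ∨ Q ≠ 0 := by
  by_cases hω : ω = 0
  · right
    subst hω
    have : Tendsto (fun n => recSeq (fun k => d k * (0 : ℂ)) 1 1 (N + n) /
      recSeq (fun k => d (N + k) * (0 : ℂ)) 1 1 n) atTop (𝓝 1) := by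
      have h1 : ∀ (e : ℕ → ℂ) (n : ℕ), (∀ k, e k = 0) → recSeq e 1 1 n = 1 := by
        intro e n he
        cases n with
        | zero => simp [recSeq]
        | succ n => exact recSeq_of_coeff_zero he _ _
      refine tendsto_const_nhds.congr fun n => ?_
      rw [h1 _ _ (by simp), h1 _ _ (by simp), div_one]
    rw [tendsto_nhds_unique hQ this]
    exact one_ne_zero
  · set A := recSeq (fun k => d k * ω) 0 1 with hA
    set B := recSeq (fun k => d k * ω) 1 1 with hB
    set D := recSeq (fun k => d (N + k) * ω) 1 1 with hDdef
    have hW : A (N + 1) * B N - A N * B (N + 1) ≠ 0 := by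
      rw [casoratian (fun k => d k * ω) (recSeq_add_two _ 0 1) (recSeq_add_two _ 1 1)]
      refine mul_ne_zero (Finset.prod_ne_zero_iff.2 fun i _ => mul_ne_zero (hd0 i) hω) ?_
      simp [hA, hB, recSeq]
    set W := A (N + 1) * B N - A N * B (N + 1) with hWdef
    have hlin : ∀ n, D n = (B N - B (N + 1)) / W * A (N + n) +
        (A (N + 1) - A N) / W * B (N + n) := by
      refine recSeq_ext (fun k => d (N + k) * ω) (recSeq_add_two _ 1 1) (fun n => ?_) ?_ ?_
      · rw [hA, hB, recSeq_shift, recSeq_shift]; ring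
      · have : D 0 = 1 := by simp [hDdef, recSeq]
        rw [this, add_zero]
        field_simp
        rw [hWdef]; ring
      · have : D 1 = 1 := by simp [hDdef, recSeq]
        rw [this]
        field_simp
        rw [hWdef]; ring
    have hlim := (hP.const_mul ((B N - B (N + 1)) / W)).add (hQ.const_mul ((A (N + 1) - A N) / W))
    have hone : Tendsto (fun _ : ℕ => (1 : ℂ)) atTop
        (𝓝 ((B N - B (N + 1)) / W * P + (A (N + 1) - A N) / W * Q)) := by
      refine hlim.congr fun n => ?_
      rw [← mul_div_assoc, ← mul_div_assoc, ← add_div, ← hlin, div_self (hD n)]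
    have := tendsto_nhds_unique hone tendsto_const_nhds
    by_contra! hcon
    rw [hcon.1, hcon.2] at this
    simp at this

end Limits

/-! ### The limit of the coefficients -/

section CoeffLimit

lemma tendsto_coeff (a b c : ℂ) : Tendsto (coeff a b c) atTop (𝓝 (1 / 4)) := by
  have hlin : ∀ (x y z w : ℂ), Tendsto (fun j : ℕ => (x + j) * (y + j) /
      ((z + 2 * j) * (w + 2 * j))) atTop (𝓝 (1 / 4)) := by
    intro x y z w
    have hdiv : ∀ x : ℂ, Tendsto (fun j : ℕ => x / j) atTop (𝓝 0) :=
      fun x => tendsto_const_div_atTop_nhds_zero_nat x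
    have h : Tendsto (fun j : ℕ => (x / j + 1) * (y / j + 1) / ((z / j + 2) * (w / j + 2))) atTop
        (𝓝 ((0 + 1) * (0 + 1) / ((0 + 2) * (0 + 2)))) :=
      (((hdiv x).add_const 1).mul ((hdiv y).add_const 1)).div
        (((hdiv z).add_const 2).mul ((hdiv w).add_const 2)) (by norm_num)
    have e : ((0 + 1) * (0 + 1) / ((0 + 2) * (0 + 2)) : ℂ) = 1 / 4 := by norm_num
    rw [e] at h
    refine h.congr' ?_
    filter_upwards [eventually_ne_atTop 0] with j hj
    have hj' : (j : ℂ) ≠ 0 := by exact_mod_cast hj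
    have e1 : x + j = j * (x / j + 1) := by field_simp
    have e2 : y + j = j * (y / j + 1) := by field_simp
    have e3 : z + 2 * j = j * (z / j + 2) := by field_simp
    have e4 : w + 2 * j = j * (w / j + 2) := by field_simp
    rw [e1, e2, e3, e4, mul_mul_mul_comm, mul_mul_mul_comm (j : ℂ) _ (j : ℂ),
      mul_div_mul_left _ _ (mul_ne_zero hj' hj')]
  have hhalf : Tendsto (fun n : ℕ => n / 2) atTop atTop :=
    Nat.tendsto_div_const_atTop two_ne_zero
  have h1 := (hlin a (c - b) (c - 1) c).comp hhalf
  have h2 := (hlin b (c - a) c (c + 1)).comp hhalf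
  refine (h1.if' h2 (p := fun n => Even n)).congr fun n => ?_
  simp only [coeff, Function.comp_apply]
  split_ifs
  · congr 2; ring
  · congr 2; ring

end CoeffLimit

lemma isPreconnected_cutPlane : IsPreconnected cutPlane := by
  have : cutPlane = cutDisk 1 := by
    refine Set.Subset.antisymm (fun ω hω => ?_) (cutDisk_subset_cutPlane le_rfl)
    obtain ⟨r, hr, rfl⟩ := exists_cutMap_eq hω
    exact ⟨r, by simpa using hr, rfl⟩
  rw [this]
  exact isPreconnected_cutDisk le_rfl

/-! ### The quotient as a meromorphic function -/

section Ratio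

variable {F₀ F₁ : ℂ → ℂ}

lemma meromorphicOn_ratio (hF₀ : AnalyticOnNhd ℂ F₀ cutPlane) (hF₁ : AnalyticOnNhd ℂ F₁ cutPlane) :
    MeromorphicOn (fun ω => F₁ ω / F₀ ω) cutPlane :=
  fun ω hω => (hF₁ ω hω).meromorphicAt.div (hF₀ ω hω).meromorphicAt

lemma eventually_ne_zero (hF₀ : AnalyticOnNhd ℂ F₀ cutPlane) (h0 : F₀ 0 ≠ 0) {ω : ℂ}
    (hω : ω ∈ cutPlane) : ∀ᶠ z in 𝓝[≠] ω, F₀ z ≠ 0 := by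
  rcases (hF₀ ω hω).eventually_eq_zero_or_eventually_ne_zero with h | h
  · exact absurd (hF₀.eqOn_zero_of_preconnected_of_eventuallyEq_zero isPreconnected_cutPlane hω h
      (ball_subset_cutPlane (by simp))) h0
  · exact h

/-- Zeros of `F₀` are isolated, and where `F₀ ≠ 0` the relation `F₁ Q = F₀ P` excludes `Q = 0`,
since `P` would vanish too. -/
lemma meroRatio_eventuallyEq (hF₀ : AnalyticOnNhd ℂ F₀ cutPlane)
    (hF₁ : AnalyticOnNhd ℂ F₁ cutPlane) (h0 : F₀ 0 ≠ 0) {U : Set ℂ} (hU : IsOpen U)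
    (hUc : U ⊆ cutPlane) {P Q : ℂ → ℂ} (hPQ : ∀ z ∈ U, P z ≠ 0 ∨ Q z ≠ 0)
    (hrel : ∀ z ∈ U, F₁ z * Q z = F₀ z * P z) {ω : ℂ} (hω : ω ∈ U) :
    (∀ᶠ z in 𝓝[≠] ω, Q z ≠ 0) ∧ meroRatio F₁ F₀ =ᶠ[𝓝[≠] ω] fun z => P z / Q z := by
  have hne : ∀ᶠ z in 𝓝[≠] ω, Q z ≠ 0 ∧ F₁ z / F₀ z = P z / Q z := by
    filter_upwards [eventually_ne_zero hF₀ h0 (hUc hω),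
      mem_nhdsWithin_of_mem_nhds (hU.mem_nhds hω)] with z hz hzU
    have hr := hrel z hzU
    have hQ : Q z ≠ 0 := by
      intro hQ
      rw [hQ, mul_zero, eq_comm, mul_eq_zero, or_iff_right hz] at hr
      exact (hPQ z hzU).elim (· hr) (· hQ)
    exact ⟨hQ, (div_eq_div_iff hz hQ).2 (by rw [hr, mul_comm])⟩
  refine ⟨hne.mono fun z hz => hz.1, ?_⟩
  refine ((meromorphicOn_ratio hF₀ hF₁).toMeromorphicNFOn_eq_self_on_nhdsNE (hUc hω)).trans ?_
  exact hne.mono fun z hz => hz.2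

lemma meroRatio_value (hF₀ : AnalyticOnNhd ℂ F₀ cutPlane)
    (hF₁ : AnalyticOnNhd ℂ F₁ cutPlane) (h0 : F₀ 0 ≠ 0) {U : Set ℂ} (hU : IsOpen U)
    (hUc : U ⊆ cutPlane) {P Q : ℂ → ℂ} (hP : AnalyticOnNhd ℂ P U) (hQ : AnalyticOnNhd ℂ Q U)
    (hPQ : ∀ z ∈ U, P z ≠ 0 ∨ Q z ≠ 0)
    (hrel : ∀ z ∈ U, F₁ z * Q z = F₀ z * P z) {ω : ℂ} (hω : ω ∈ U) :
    (Q ω ≠ 0 → meroRatio F₁ F₀ ω = P ω / Q ω ∧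
      meroValue (meroRatio F₁ F₀) ω = ((P ω / Q ω : ℂ) : OnePoint ℂ)) ∧
    (Q ω = 0 → meroValue (meroRatio F₁ F₀) ω = OnePoint.infty) := by
  have hNF : MeromorphicNFAt (meroRatio F₁ F₀) ω := meromorphicNFOn_toMeromorphicNFOn _ _ (hUc hω)
  obtain ⟨hQne, heq⟩ := meroRatio_eventuallyEq hF₀ hF₁ h0 hU hUc hPQ hrel hω
  constructor
  · intro hQω
    have han : AnalyticAt ℂ (fun z => P z / Q z) ω := (hP ω hω).div (hQ ω hω) hQω
    have hval := ((hNF.eventuallyEq_nhdsNE_iff_eventuallyEq_nhds han.meromorphicNFAt).1 heq)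
    refine ⟨hval.eq_of_nhds, ?_⟩
    rw [meroValue, if_neg, hval.eq_of_nhds]
    rw [not_lt, meromorphicOrderAt_congr heq]
    exact han.meromorphicOrderAt_nonneg
  · intro hQω
    rw [meroValue, if_pos]
    by_contra hcon
    -- Without a pole the quotient has a finite limit `l`, so `P = (P/Q) Q` tends to `l * 0` and
    -- `P`, `Q` vanish together.
    rw [not_lt, ← tendsto_nhds_iff_meromorphicOrderAt_nonneg hNF.meromorphicAt] at hcon
    obtain ⟨l, hl⟩ := hcon
    have h1 : Tendsto Q (𝓝[≠] ω) (𝓝 0) := by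
      rw [← hQω]
      exact (hQ ω hω).continuousAt.tendsto.mono_left nhdsWithin_le_nhds
    have h2 : Tendsto P (𝓝[≠] ω) (𝓝 (P ω)) :=
      (hP ω hω).continuousAt.tendsto.mono_left nhdsWithin_le_nhds
    have h3 : Tendsto P (𝓝[≠] ω) (𝓝 (l * 0)) := by
      refine (hl.mul h1).congr' ?_
      filter_upwards [heq, hQne] with z hz hzQ
      rw [hz, div_mul_cancel₀ _ hzQ]
    have := tendsto_nhds_unique h2 h3
    rw [mul_zero] at this
    exact (hPQ ω hω).elim (· this) (· hQω)

end Ratio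

/-! ### Values in the Riemann sphere and convergence -/

section RatFuncValue

/-- Coprimality keeps numerator and denominator from vanishing together, so both pairs are
homogeneous coordinates of one point of the projective line. -/
lemma ratFunc_denom_eval_eq_zero_iff {R : RatFunc ℂ} {ω p q : ℂ}
    (h : R.num.eval ω * q = p * R.denom.eval ω) (hpq : p ≠ 0 ∨ q ≠ 0) :
    (R.denom.eval ω = 0 ↔ q = 0) ∧ (q ≠ 0 → R.eval (RingHom.id ℂ) ω = p / q) := by
  have hcop : ¬ (R.num.eval ω = 0 ∧ R.denom.eval ω = 0) := by
    rintro ⟨h1, h2⟩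
    obtain ⟨u, v, huv⟩ := R.isCoprime_num_denom
    have := congrArg (Polynomial.eval ω) huv
    simp [h1, h2] at this
  have hiff : R.denom.eval ω = 0 ↔ q = 0 := by
    constructor
    · intro hd
      rw [hd, mul_zero, mul_eq_zero] at h
      exact h.resolve_left fun hn => hcop ⟨hn, hd⟩
    · intro hq
      rw [hq, mul_zero, eq_comm, mul_eq_zero] at h
      exact h.resolve_left (hpq.resolve_right (· hq))
  refine ⟨hiff, fun hq => ?_⟩
  rw [RatFunc.eval, Polynomial.eval₂_id, Polynomial.eval₂_id,
    div_eq_div_iff (fun hd => hq (hiff.1 hd)) hq, h]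

end RatFuncValue

section Convergence

variable {F₀ F₁ : ℂ → ℂ} {R : ℕ → RatFunc ℂ} {U : Set ℂ} {p q : ℕ → ℂ → ℂ} {P Q : ℂ → ℂ}

lemma tendsto_ratValue {ω P Q : ℂ} {p q : ℕ → ℂ} (hP : Tendsto p atTop (𝓝 P))
    (hQ : Tendsto q atTop (𝓝 Q)) (hPQ : P ≠ 0 ∨ Q ≠ 0)
    (hR : ∀ᶠ n in atTop, (R n).num.eval ω * q n = p n * (R n).denom.eval ω) :
    (Q ≠ 0 → Tendsto (fun n => ratValue (R n) ω) atTop (𝓝 ((P / Q : ℂ) : OnePoint ℂ))) ∧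
    (Q = 0 → Tendsto (fun n => ratValue (R n) ω) atTop (𝓝 OnePoint.infty)) := by
  constructor
  · intro hQ0
    have h1 : Tendsto (fun n => ((p n / q n : ℂ) : OnePoint ℂ)) atTop
        (𝓝 ((P / Q : ℂ) : OnePoint ℂ)) :=
      (OnePoint.continuous_coe.tendsto _).comp (hP.div hQ hQ0)
    refine h1.congr' ?_
    filter_upwards [hR, hQ.eventually_ne hQ0] with n hn hqn
    obtain ⟨h2, h3⟩ := ratFunc_denom_eval_eq_zero_iff hn (Or.inr hqn)
    rw [ratValue, if_neg (fun h => hqn (h2.1 h)), h3 hqn]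
  · intro hQ0
    have hP0 : P ≠ 0 := hPQ.resolve_right (· hQ0)
    rw [OnePoint.hasBasis_nhds_infty.tendsto_right_iff]
    rintro s ⟨-, hs⟩
    obtain ⟨M, hM0, hM⟩ := hs.isBounded.exists_pos_norm_le
    -- Here `q n → 0` while `p n` stays away from `0`, so the quotient leaves every bounded set.
    have hsmall : ∀ᶠ n in atTop, M * ‖q n‖ < ‖p n‖ := by
      refine Tendsto.eventually_lt (hQ.norm.const_mul M) hP.norm ?_
      simpa [hQ0] using hP0
    filter_upwards [hR, hsmall, hP.eventually_ne hP0] with n hn hlt hpn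
    obtain ⟨h2, h3⟩ := ratFunc_denom_eval_eq_zero_iff hn (Or.inl hpn)
    rw [ratValue]
    split_ifs with hd
    · right; rfl
    · left
      have hqn : q n ≠ 0 := fun h => hd (h2.2 h)
      refine ⟨_, fun hmem => ?_, rfl⟩
      have := hM _ hmem
      rw [h3 hqn, norm_div, div_le_iff₀ (norm_pos_iff.2 hqn)] at this
      linarith

/-- If the approximants are ratios of uniformly convergent functions whose limits have no common
zeros, they converge to the meromorphic function defined by the ratio of the limits. -/
theorem convergence_of_uniform_limits (hF₀ : AnalyticOnNhd ℂ F₀ cutPlane)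
    (hF₁ : AnalyticOnNhd ℂ F₁ cutPlane) (h0 : F₀ 0 ≠ 0) (hU : IsOpen U) (hUc : U ⊆ cutPlane)
    (hP : AnalyticOnNhd ℂ P U) (hQ : AnalyticOnNhd ℂ Q U) (hPQ : ∀ z ∈ U, P z ≠ 0 ∨ Q z ≠ 0)
    (hrel : ∀ z ∈ U, F₁ z * Q z = F₀ z * P z)
    (hp : TendstoUniformlyOn p P atTop U) (hq : TendstoUniformlyOn q Q atTop U)
    (hR : ∀ᶠ n in atTop, ∀ z ∈ U, (R n).num.eval z * q n z = p n z * (R n).denom.eval z) :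
    (∀ ω ∈ U, Tendsto (fun n => ratValue (R n) ω) atTop (𝓝 (meroValue (meroRatio F₁ F₀) ω))) ∧
    ∀ K ⊆ U, IsCompact K → (∀ ω ∈ K, meroValue (meroRatio F₁ F₀) ω ≠ OnePoint.infty) →
      (∀ᶠ n in atTop, ∀ ω ∈ K, (R n).denom.eval ω ≠ 0) ∧
      TendstoUniformlyOn (fun n ω => (R n).eval (RingHom.id ℂ) ω) (meroRatio F₁ F₀) atTop K := by
  have hval := fun {ω} (hω : ω ∈ U) => meroRatio_value hF₀ hF₁ h0 hU hUc hP hQ hPQ hrel hω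
  constructor
  · intro ω hω
    have ht := tendsto_ratValue (hp.tendsto_at hω) (hq.tendsto_at hω) (hPQ ω hω)
      (hR.mono fun n hn => hn ω hω)
    by_cases hQω : Q ω = 0
    · rw [(hval hω).2 hQω]; exact ht.2 hQω
    · rw [((hval hω).1 hQω).2]; exact ht.1 hQω
  · intro K hKU hK hfin
    have hQK : ∀ ω ∈ K, Q ω ≠ 0 := fun ω hω h => hfin ω hω ((hval (hKU hω)).2 h)
    have hcP : ContinuousOn P K := hP.continuousOn.mono hKU
    have hcQ : ContinuousOn Q K := hQ.continuousOn.mono hKU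
    have hqK := hq.mono hKU
    have hqne : ∀ᶠ n in atTop, ∀ ω ∈ K, q n ω ≠ 0 := by
      rcases K.eq_empty_or_nonempty with rfl | hKne
      · simp
      -- The positive minimum of `‖Q‖` on `K` is the tolerance that keeps `q n` from vanishing.
      obtain ⟨ω₀, hω₀, hmin⟩ := hK.exists_isMinOn hKne hcQ.norm
      filter_upwards [Metric.tendstoUniformlyOn_iff.1 hqK _ (norm_pos_iff.2 (hQK ω₀ hω₀))]
        with n hn ω hω h
      have h1 := hn ω hω
      rw [h, dist_zero_right] at h1
      exact absurd (hmin hω) (not_le.2 h1)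
    have hloc : TendstoLocallyUniformlyOn (p / q) (P / Q) atTop K :=
      (hp.mono hKU).tendstoLocallyUniformlyOn.div₀ hqK.tendstoLocallyUniformlyOn hcP hcQ hQK
    have hunif : TendstoUniformlyOn (p / q) (P / Q) atTop K :=
      (tendstoLocallyUniformlyOn_iff_tendstoUniformlyOn_of_compact hK).1 hloc
    constructor
    · filter_upwards [hqne, hR] with n hn hRn ω hω hd
      exact hn ω hω ((ratFunc_denom_eval_eq_zero_iff (hRn ω (hKU hω)) (Or.inr (hn ω hω))).1.1 hd)
    · refine (hunif.congr ?_).congr_right fun ω hω => ?_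
      · filter_upwards [hqne, hR] with n hn hRn ω hω
        exact ((ratFunc_denom_eval_eq_zero_iff (hRn ω (hKU hω)) (Or.inr (hn ω hω))).2
          (hn ω hω)).symm
      · exact ((hval (hKU hω)).1 (hQK ω hω)).1.symm

end Convergence

/-! ### Hypergeometric functions on the unit disk -/

section Series

/-- The radius is infinite when `a` or `b` is a nonpositive integer and `1` otherwise. -/
lemma one_le_radius_hypSeries (a b : ℂ) {c : ℂ} (hc : ∀ n : ℕ, c ≠ -(n : ℂ)) :
    1 ≤ (ordinaryHypergeometricSeries ℂ a b c).radius := by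
  by_cases ha : ∃ k : ℕ, a = -(k : ℂ)
  · obtain ⟨k, rfl⟩ := ha
    rw [ordinaryHypergeometric_radius_top_of_neg_nat₁]
    exact le_top
  by_cases hb : ∃ k : ℕ, b = -(k : ℂ)
  · obtain ⟨k, rfl⟩ := hb
    rw [ordinaryHypergeometric_radius_top_of_neg_nat₂]
    exact le_top
  push Not at ha hb
  refine (ordinaryHypergeometricSeries_radius_eq_one ℂ a b c fun k => ⟨?_, ?_, ?_⟩).ge
  · exact fun h => ha k (by rw [h, neg_neg])
  · exact fun h => hb k (by rw [h, neg_neg])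
  · exact fun h => hc k (by rw [h, neg_neg])

lemma hasFPowerSeriesOnBall_hyp (a b : ℂ) {c : ℂ} (hc : ∀ n : ℕ, c ≠ -(n : ℂ)) :
    HasFPowerSeriesOnBall (ordinaryHypergeometric a b c : ℂ → ℂ)
      (ordinaryHypergeometricSeries ℂ a b c) 0 1 :=
  ((ordinaryHypergeometricSeries ℂ a b c).hasFPowerSeriesOnBall
    (zero_lt_one.trans_le (one_le_radius_hypSeries a b hc))).mono zero_lt_one
    (one_le_radius_hypSeries a b hc)

lemma eball_one_eq_ball : Metric.eball (0 : ℂ) 1 = Metric.ball 0 1 := by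
  rw [← ENNReal.ofReal_one, Metric.eball_ofReal]

lemma hasSum_hyp (a b : ℂ) {c : ℂ} (hc : ∀ n : ℕ, c ≠ -(n : ℂ)) {ω : ℂ}
    (hω : ω ∈ Metric.ball (0 : ℂ) 1) :
    HasSum (fun n => ordinaryHypergeometricCoefficient a b c n * ω ^ n)
      (ordinaryHypergeometric a b c ω) := by
  have := (hasFPowerSeriesOnBall_hyp a b hc).hasSum (y := ω) (by rwa [eball_one_eq_ball])
  simpa only [ordinaryHypergeometricSeries_apply_eq, zero_add, smul_eq_mul] using this

lemma differentiableOn_hyp (a b : ℂ) {c : ℂ} (hc : ∀ n : ℕ, c ≠ -(n : ℂ)) :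
    DifferentiableOn ℂ (ordinaryHypergeometric a b c : ℂ → ℂ) (Metric.ball 0 1) := by
  rw [← eball_one_eq_ball]
  exact (hasFPowerSeriesOnBall_hyp a b hc).differentiableOn

lemma hasSum_contiguous {f₀ f₁ f₂ : ℕ → ℂ} {d ω S₀ S₁ S₂ : ℂ} (h0 : f₀ 0 = f₁ 0)
    (h : ∀ k, f₀ (k + 1) = f₁ (k + 1) - d * f₂ k)
    (hS₀ : HasSum (fun n => f₀ n * ω ^ n) S₀) (hS₁ : HasSum (fun n => f₁ n * ω ^ n) S₁)
    (hS₂ : HasSum (fun n => f₂ n * ω ^ n) S₂) : S₀ = S₁ - d * ω * S₂ := by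
  have h1 := (hasSum_nat_add_iff' 1).2 hS₁
  have h2 := h1.sub (hS₂.mul_left (d * ω))
  have h3 := (hasSum_nat_add_iff' 1).2 hS₀
  have h4 := h3.unique (h2.congr_fun fun k => ?_)
  · simp only [Finset.range_one, Finset.sum_singleton, pow_zero, mul_one, h0] at h4
    linear_combination h4
  · simp only [h]
    ring

lemma hyp_contiguous (a b : ℂ) {c : ℂ} (hc : ∀ n : ℕ, c ≠ -(n : ℂ)) {ω : ℂ}
    (hω : ω ∈ Metric.ball (0 : ℂ) 1) :
    ordinaryHypergeometric a b c ω = ordinaryHypergeometric (a + 1) b (c + 1) ω -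
      b * (c - a) / (c * (c + 1)) * ω * ordinaryHypergeometric (a + 1) (b + 1) (c + 2) ω :=
  hasSum_contiguous (by rw [hypCoeff_zero, hypCoeff_zero]) (hypCoeff_contiguous a b hc)
    (hasSum_hyp a b hc hω)
    (hasSum_hyp _ _ (by simpa using add_natCast_ne_neg hc 1) hω)
    (hasSum_hyp _ _ (by simpa using add_natCast_ne_neg hc 2) hω)

/-- The functions in Gauss's chain of contiguous functions, on the unit disk. -/
def chainFun (a b c : ℂ) (n : ℕ) (ω : ℂ) : ℂ :=
  ordinaryHypergeometric (a + ((n + 1) / 2 : ℕ)) (b + (n / 2 : ℕ)) (c + n) ω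

lemma chainFun_contiguous (a b : ℂ) {c : ℂ} (hc : ∀ n : ℕ, c ≠ -(n : ℂ)) {ω : ℂ}
    (hω : ω ∈ Metric.ball (0 : ℂ) 1) (n : ℕ) :
    chainFun a b c n ω = chainFun a b c (n + 1) ω -
      coeff a b c (n + 1) * ω * chainFun a b c (n + 2) ω :=
  hasSum_contiguous (by rw [chainCoeff, chainCoeff, hypCoeff_zero, hypCoeff_zero])
    (chainCoeff_contiguous a b hc n)
    (hasSum_hyp _ _ (add_natCast_ne_neg hc n) hω)
    (hasSum_hyp _ _ (add_natCast_ne_neg hc (n + 1)) hω)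
    (hasSum_hyp _ _ (add_natCast_ne_neg hc (n + 2)) hω)

lemma chainFun_zero (a b c : ℂ) : chainFun a b c 0 = ordinaryHypergeometric a b c := by
  ext ω; simp [chainFun]

lemma chainFun_one (a b c : ℂ) :
    chainFun a b c 1 = ordinaryHypergeometric (a + 1) b (c + 1) := by
  ext ω; simp [chainFun]

end Series

/-! ### Euler's integral representation -/

section Euler

open MeasureTheory

/-- The slit plane is star-shaped about `1`, and `1 - ω t` lies on the segment from `1` to `1 - ω`.
-/
lemma one_sub_mul_mem_slitPlane {ω : ℂ} (hω : ω ∈ cutPlane) {t : ℝ} (ht : t ∈ Set.Icc (0 : ℝ) 1) :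
    1 - ω * t ∈ Complex.slitPlane := by
  have h := Complex.starConvex_one_slitPlane (mem_cutPlane_iff.1 hω) (sub_nonneg.2 ht.2) ht.1
    (sub_add_cancel 1 t)
  convert h using 1
  simp only [Complex.real_smul]
  push_cast
  ring

lemma continuousOn_kernel (s : ℂ) : ContinuousOn (fun x : ℂ × ℝ => (1 - x.1 * x.2) ^ s)
    (cutPlane ×ˢ Set.Icc 0 1) := by
  refine ContinuousOn.cpow (by fun_prop) continuousOn_const fun x hx => ?_
  exact one_sub_mul_mem_slitPlane hx.1 hx.2

lemma continuousOn_kernel_right (s : ℂ) {ω : ℂ} (hω : ω ∈ cutPlane) :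
    ContinuousOn (fun t : ℝ => (1 - ω * t) ^ s) (Set.uIoc 0 1) := by
  refine (continuousOn_kernel s).comp (f := fun t : ℝ => (ω, t)) (by fun_prop) fun t ht => ?_
  rw [Set.uIoc_of_le zero_le_one] at ht
  exact ⟨hω, ht.1.le, ht.2⟩

/-- Integrals of Euler type are holomorphic on the cut plane. -/
lemma differentiableOn_eulerIntegral {φ : ℝ → ℂ} (hφ : IntervalIntegrable φ volume 0 1) (s : ℂ) :
    DifferentiableOn ℂ (fun ω : ℂ => ∫ t in (0 : ℝ)..1, φ t * (1 - ω * t) ^ s) cutPlane := by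
  intro ω₀ hω₀
  obtain ⟨ε, hε, hball⟩ := Metric.nhds_basis_closedBall.mem_iff.1 (isOpen_cutPlane.mem_nhds hω₀)
  have hφm : AEStronglyMeasurable φ (volume.restrict (Set.uIoc 0 1)) :=
    hφ.def'.aestronglyMeasurable
  have hcpt : IsCompact (Metric.closedBall ω₀ ε ×ˢ Set.Icc (0 : ℝ) 1) :=
    (isCompact_closedBall _ _).prod isCompact_Icc
  have hsub : Metric.closedBall ω₀ ε ×ˢ Set.Icc (0 : ℝ) 1 ⊆ cutPlane ×ˢ Set.Icc 0 1 :=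
    Set.prod_mono hball subset_rfl
  have hcont : ContinuousOn (fun x : ℂ × ℝ => s * (1 - x.1 * x.2) ^ (s - 1) * (-x.2))
      (cutPlane ×ˢ Set.Icc 0 1) :=
    (continuousOn_const.mul (continuousOn_kernel (s - 1))).mul (by fun_prop)
  obtain ⟨M, hM⟩ := hcpt.exists_bound_of_continuousOn (hcont.mono hsub)
  have hmem : ∀ t ∈ Set.uIoc (0 : ℝ) 1, t ∈ Set.Icc (0 : ℝ) 1 := fun t ht => by
    rw [Set.uIoc_of_le zero_le_one] at ht
    exact ⟨ht.1.le, ht.2⟩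
  have hkm : ∀ ω ∈ cutPlane, ∀ s : ℂ, AEStronglyMeasurable (fun t : ℝ => (1 - ω * t) ^ s)
      (volume.restrict (Set.uIoc 0 1)) := fun ω hω s =>
    (continuousOn_kernel_right s hω).aestronglyMeasurable measurableSet_uIoc
  have hint : IntervalIntegrable (fun t => φ t * (1 - ω₀ * t) ^ s) volume 0 1 := by
    refine hφ.mul_continuousOn ?_
    refine (continuousOn_kernel s).comp (f := fun t : ℝ => (ω₀, t)) (by fun_prop) fun t ht => ?_
    rw [Set.uIcc_of_le zero_le_one] at ht
    exact ⟨hω₀, ht⟩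
  have := intervalIntegral.hasDerivAt_integral_of_dominated_loc_of_deriv_le
    (F := fun ω t => φ t * (1 - ω * t) ^ s)
    (F' := fun ω t => φ t * (s * (1 - ω * t) ^ (s - 1) * (-t)))
    (bound := fun t => ‖φ t‖ * M) (μ := volume) (a := 0) (b := 1) (x₀ := ω₀)
    (Metric.closedBall_mem_nhds ω₀ hε) ?_ hint ?_ ?_ ?_ ?_
  · exact this.2.differentiableAt.differentiableWithinAt
  · filter_upwards [isOpen_cutPlane.mem_nhds hω₀] with ω hω
    exact hφm.mul (hkm ω hω s)
  · refine hφm.mul (((hkm ω₀ hω₀ (s - 1)).const_mul s).mul ?_)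
    exact (by fun_prop : Continuous fun t : ℝ => -(t : ℂ)).aestronglyMeasurable
  · refine Eventually.of_forall fun t ht ω hω => ?_
    rw [norm_mul]
    gcongr
    exact hM (ω, t) ⟨hω, hmem t ht⟩
  · exact hφ.norm.mul_const M
  · refine Eventually.of_forall fun t ht ω hω => ?_
    have h1 : HasDerivAt (fun ω : ℂ => 1 - ω * t) (-t) ω := by
      simpa using ((hasDerivAt_id ω).mul_const (t : ℂ)).const_sub 1
    exact (h1.cpow_const (one_sub_mul_mem_slitPlane (hball hω) (hmem t ht))).const_mul (φ t)

lemma choose_eq_ascPochhammer (a : ℂ) (n : ℕ) :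
    Ring.choose (a + n - 1) n = (ascPochhammer ℂ n).eval a / n.factorial := by
  have h := Ring.factorial_nsmul_multichoose_eq_ascPochhammer a n
  rw [Polynomial.ascPochhammer_smeval_eq_eval, nsmul_eq_mul] at h
  rw [Ring.choose, ← h, mul_div_cancel_left₀ _ (by exact_mod_cast n.factorial_ne_zero)]
  congr 1
  ring

/-- The absolute convergence supplies the dominating series for termwise integration in Euler's
formula. -/
lemma hasSum_one_sub_cpow (a : ℂ) {z : ℂ} (hz : ‖z‖ < 1) :
    HasSum (fun n : ℕ => (ascPochhammer ℂ n).eval a / n.factorial * z ^ n) ((1 - z) ^ (-a)) ∧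
    Summable (fun n : ℕ => ‖(ascPochhammer ℂ n).eval a / n.factorial‖ * ‖z‖ ^ n) := by
  have h := Complex.one_div_one_sub_cpow_hasFPowerSeriesOnBall_zero a
  have hz' : z ∈ Metric.eball (0 : ℂ) 1 := by rw [eball_one_eq_ball]; simpa using hz
  constructor
  · have := h.hasSum hz'
    simpa only [FormalMultilinearSeries.ofScalars_apply_eq, choose_eq_ascPochhammer, smul_eq_mul,
      zero_add, one_div, ← Complex.cpow_neg] using this
  · have := FormalMultilinearSeries.summable_norm_apply _
      (Metric.eball_subset_eball h.r_le hz')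
    simpa only [FormalMultilinearSeries.ofScalars_apply_eq, choose_eq_ascPochhammer, smul_eq_mul,
      norm_mul, norm_pow] using this

lemma integral_beta_mul_pow {b v : ℂ} (hb : 0 < b.re) (hv : 0 < v.re) (n : ℕ) :
    ∫ t in (0 : ℝ)..1, (t : ℂ) ^ (b - 1) * (1 - (t : ℂ)) ^ (v - 1) * (t : ℂ) ^ n =
      Complex.Gamma (b + n) * Complex.Gamma v / Complex.Gamma (b + v + n) := by
  have h := Complex.betaIntegral_eq_Gamma_mul_div (b + n) v (by simp; positivity) hv
  rw [add_right_comm, ← h, Complex.betaIntegral]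
  refine intervalIntegral.integral_congr_ae (Eventually.of_forall fun t ht => ?_)
  rw [Set.uIoc_of_le zero_le_one] at ht
  have ht0 : (t : ℂ) ≠ 0 := by exact_mod_cast ht.1.ne'
  have : b + n - 1 = b - 1 + n := by ring
  rw [this, Complex.cpow_add _ _ ht0, Complex.cpow_natCast]
  ring

lemma ne_neg_nat_of_re_pos {c : ℂ} (hc : 0 < c.re) (n : ℕ) : c ≠ -(n : ℂ) := by
  rintro rfl
  simp at hc
  have : (0 : ℝ) ≤ n := n.cast_nonneg
  linarith

/-- Euler's integral representation provides the continuation if `0 < Re b < Re c`. -/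
lemma exists_continuation_of_re_pos (a : ℂ) {b c : ℂ} (hb : 0 < b.re) (hbc : 0 < (c - b).re) :
    ∃ F, IsHypContinuation a b c F := by
  have hc : 0 < c.re := by simp at hbc; linarith
  set φ : ℝ → ℂ := fun t => (t : ℂ) ^ (b - 1) * (1 - (t : ℂ)) ^ (c - b - 1) with hφdef
  have hφ : IntervalIntegrable φ volume 0 1 := Complex.betaIntegral_convergent hb hbc
  refine ⟨fun ω => Complex.Gamma c / (Complex.Gamma b * Complex.Gamma (c - b)) *
    ∫ t in (0 : ℝ)..1, φ t * (1 - ω * t) ^ (-a), ?_, fun ω hω => ?_⟩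
  · exact ((differentiableOn_eulerIntegral hφ (-a)).const_mul _).analyticOnNhd isOpen_cutPlane
  · have hω1 : ‖ω‖ < 1 := by simpa using hω
    set p : ℕ → ℂ := fun n => (ascPochhammer ℂ n).eval a / n.factorial with hp
    have hsum := (hasSum_one_sub_cpow a hω1).2
    have hmain : HasSum (fun n => ∫ t in (0 : ℝ)..1, φ t * (p n * (ω * t) ^ n))
        (∫ t in (0 : ℝ)..1, φ t * (1 - ω * t) ^ (-a)) := by
      refine intervalIntegral.hasSum_integral_of_dominated_convergence
        (fun n t => ‖φ t‖ * (‖p n‖ * ‖ω‖ ^ n)) (fun n => ?_) (fun n => ?_) ?_ ?_ ?_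
      · refine hφ.def'.aestronglyMeasurable.mul ?_
        exact (by fun_prop : Continuous fun t : ℝ => p n * (ω * t) ^ n).aestronglyMeasurable
      · refine Eventually.of_forall fun t ht => ?_
        rw [Set.uIoc_of_le zero_le_one] at ht
        rw [norm_mul (φ t), norm_mul (p n), norm_pow, norm_mul ω, Complex.norm_real, Real.norm_of_nonneg ht.1.le]
        have hle : ‖ω‖ * t ≤ ‖ω‖ := mul_le_of_le_one_right (norm_nonneg _) ht.2
        have ht0 : 0 ≤ t := ht.1.le
        gcongr
      · exact Eventually.of_forall fun t _ => hsum.mul_left _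
      · simp_rw [tsum_mul_left]
        exact hφ.norm.mul_const _
      · refine Eventually.of_forall fun t ht => ?_
        rw [Set.uIoc_of_le zero_le_one] at ht
        refine (hasSum_one_sub_cpow a ?_).1.mul_left _
        rw [norm_mul, Complex.norm_real, Real.norm_of_nonneg ht.1.le]
        exact (mul_le_of_le_one_right (norm_nonneg _) ht.2).trans_lt hω1
    have hterm : ∀ n, ∫ t in (0 : ℝ)..1, φ t * (p n * (ω * t) ^ n) =
        p n * ω ^ n * (Complex.Gamma (b + n) * Complex.Gamma (c - b) / Complex.Gamma (c + n)) := by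
      intro n
      have h := integral_beta_mul_pow hb hbc n
      rw [add_sub_cancel] at h
      rw [← h, ← intervalIntegral.integral_const_mul]
      congr 1
      ext t
      rw [hφdef]
      ring
    have hG := Complex.Gamma_ne_zero_of_re_pos hb
    have hG' := Complex.Gamma_ne_zero_of_re_pos hbc
    have hG'' := Complex.Gamma_ne_zero_of_re_pos hc
    have hfin := hmain.mul_left (Complex.Gamma c / (Complex.Gamma b * Complex.Gamma (c - b)))
    refine hfin.unique ((hasSum_hyp a b (ne_neg_nat_of_re_pos hc) hω).congr_fun fun n => ?_)
    have e1 := Complex.Gamma_add_nat_div_Gamma_eq (n := n) b (ne_neg_nat_of_re_pos hb)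
    have e2 := Complex.Gamma_add_nat_div_Gamma_eq (n := n) c (ne_neg_nat_of_re_pos hc)
    have hGn : Complex.Gamma (c + n) ≠ 0 :=
      Complex.Gamma_ne_zero_of_re_pos (by simp; positivity)
    rw [hterm, hp, ordinaryHypergeometricCoefficient, ← e1, ← e2]
    field_simp

end Euler

/-! ### Analytic continuation for all parameters -/

section Continuation

lemma IsHypContinuation.symm {a b c : ℂ} {F : ℂ → ℂ} (h : IsHypContinuation a b c F) :
    IsHypContinuation b a c F := by
  refine ⟨h.1, fun ω hω => ?_⟩
  rw [h.2 ω hω, ordinaryHypergeometric, ordinaryHypergeometric, ordinaryHypergeometricSeries_symm]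

lemma exists_continuation_contiguous {a b c : ℂ} (hc : ∀ n : ℕ, c ≠ -(n : ℂ))
    (h₁ : ∃ F, IsHypContinuation (a + 1) b (c + 1) F)
    (h₂ : ∃ F, IsHypContinuation (a + 1) (b + 1) (c + 2) F) :
    ∃ F, IsHypContinuation a b c F := by
  obtain ⟨F₁, hF₁⟩ := h₁
  obtain ⟨F₂, hF₂⟩ := h₂
  refine ⟨fun ω => F₁ ω - b * (c - a) / (c * (c + 1)) * ω * F₂ ω, fun ω hω => ?_, fun ω hω => ?_⟩
  · exact (hF₁.1 ω hω).sub ((analyticAt_const.mul analyticAt_id).mul (hF₂.1 ω hω))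
  · simp only [hF₁.2 ω hω, hF₂.2 ω hω, hyp_contiguous a b hc hω]

/-- Both neighbours in the contiguous relation have `c - b` raised by `1` and `Re b` not lowered, so
the induction ends at Euler's integral. -/
lemma exists_continuation_of_re_pos_left (m : ℕ) : ∀ {a b c : ℂ}, (∀ n : ℕ, c ≠ -(n : ℂ)) →
    0 < b.re → -(m : ℝ) < (c - b).re → ∃ F, IsHypContinuation a b c F := by
  induction m with
  | zero => intro a b c _ hb hbc; exact exists_continuation_of_re_pos a hb (by simpa using hbc)
  | succ m ih =>
    intro a b c hc hb hbc
    push_cast at hbc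
    simp only [Complex.sub_re] at hbc
    refine exists_continuation_contiguous hc
      (ih (by simpa using add_natCast_ne_neg hc 1) hb ?_)
      (ih (by simpa using add_natCast_ne_neg hc 2) ?_ ?_)
    · simp; linarith
    · simp; linarith
    · simp; linarith

/-- With the first two parameters exchanged, both neighbours in the contiguous relation have `b`
raised by `1`. -/
lemma exists_continuation_of_lt_re (m : ℕ) : ∀ {a b c : ℂ}, (∀ n : ℕ, c ≠ -(n : ℂ)) →
    -(m : ℝ) < b.re → ∃ F, IsHypContinuation a b c F := by
  induction m with
  | zero =>
    intro a b c hc hb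
    obtain ⟨k, hk⟩ := exists_nat_gt (-(c - b).re)
    exact exists_continuation_of_re_pos_left k hc (by simpa using hb) (by linarith)
  | succ m ih =>
    intro a b c hc hb
    push_cast at hb
    have h₁ : ∃ F, IsHypContinuation (b + 1) a (c + 1) F := by
      obtain ⟨F, hF⟩ := ih (a := a) (b := b + 1) (c := c + 1)
        (by simpa using add_natCast_ne_neg hc 1) (by simp; linarith)
      exact ⟨F, hF.symm⟩
    have h₂ : ∃ F, IsHypContinuation (b + 1) (a + 1) (c + 2) F := by
      obtain ⟨F, hF⟩ := ih (a := a + 1) (b := b + 1) (c := c + 2)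
        (by simpa using add_natCast_ne_neg hc 2) (by simp; linarith)
      exact ⟨F, hF.symm⟩
    obtain ⟨F, hF⟩ := exists_continuation_contiguous hc h₁ h₂
    exact ⟨F, hF.symm⟩

theorem exists_continuation (a b : ℂ) {c : ℂ} (hc : ∀ n : ℕ, c ≠ -(n : ℂ)) :
    ∃ F, IsHypContinuation a b c F := by
  obtain ⟨k, hk⟩ := exists_nat_gt (-b.re)
  exact exists_continuation_of_lt_re k hc (by linarith)

end Continuation

/-- A uniform limit of holomorphic functions vanishing at the origin to increasing order vanishes
identically. -/
lemma limit_eq_zero_of_pow_mul {r : ℝ} {g : ℕ → ℂ → ℂ} {G : ℂ → ℂ} {M : ℝ}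
    (hg : TendstoUniformlyOn g G atTop (Metric.ball 0 r)) (hG : ∀ z ∈ Metric.ball 0 r, ‖G z‖ ≤ M)
    (hfac : ∀ n, ∃ h : ℂ → ℂ, DifferentiableOn ℂ h (Metric.ball 0 r) ∧
      ∀ z ∈ Metric.ball 0 r, g n z = z ^ n * h z) {z : ℂ} (hz : z ∈ Metric.ball 0 r) : G z = 0 := by
  have hz' : ‖z‖ < r := by simpa using hz
  have hr : 0 < r := (norm_nonneg z).trans_lt hz'
  have h0 : (0 : ℂ) ∈ Metric.ball 0 r := by simpa using hr
  have hbound : ∀ᶠ n in atTop, ‖g n z‖ ≤ (M + 1) * (‖z‖ / r) ^ n := by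
    filter_upwards [Metric.tendstoUniformlyOn_iff.1 hg 1 one_pos, eventually_ge_atTop 1]
      with n hn hn1
    obtain ⟨k, rfl⟩ : ∃ k, n = k + 1 := ⟨n - 1, by omega⟩
    obtain ⟨h, hd, hh⟩ := hfac (k + 1)
    have hg0 : g (k + 1) 0 = 0 := by rw [hh 0 h0]; simp
    have hdg : DifferentiableOn ℂ (g (k + 1)) (Metric.ball 0 r) :=
      (((differentiable_id.pow (k + 1)).differentiableOn).mul hd).congr hh
    have hmaps : Set.MapsTo (g (k + 1)) (Metric.ball 0 r)
        (Metric.closedBall (g (k + 1) 0) (M + 1)) := by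
      intro w hw
      rw [hg0, mem_closedBall_zero_iff]
      have h1 := hn w hw
      have h2 := hG w hw
      rw [dist_comm, dist_eq_norm] at h1
      have h3 := norm_sub_norm_le (g (k + 1) w) (G w)
      linarith
    -- Schwarz's lemma of higher order: vanishing beyond order `k` and the bound `M + 1` give decay
    -- `(‖z‖ / r) ^ (k + 1)`.
    have hlo : (fun w => g (k + 1) w - g (k + 1) 0) =o[𝓝 0] fun w : ℂ => ‖w - 0‖ ^ k := by
      have h1 : (fun w : ℂ => w ^ k * (w * h w)) =o[𝓝 0] fun w : ℂ => w ^ k * (1 : ℂ) := by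
        refine (Asymptotics.isBigO_refl _ _).mul_isLittleO ?_
        rw [Asymptotics.isLittleO_one_iff]
        have hc := (hd.differentiableAt (Metric.isOpen_ball.mem_nhds h0)).continuousAt
        simpa using continuousAt_id.tendsto.mul hc.tendsto
      refine (h1.congr' ?_ EventuallyEq.rfl).trans_isBigO ?_
      · filter_upwards [Metric.isOpen_ball.mem_nhds h0] with w hw
        rw [hg0, hh w hw]
        ring
      · refine Asymptotics.isBigO_of_le _ fun w => ?_
        simp
    have := Complex.dist_le_mul_div_pow_of_mapsTo_ball_of_isLittleO hdg hmaps hlo hz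
    rwa [hg0, dist_zero_right, dist_zero_right] at this
  have hlim : Tendsto (fun n => (M + 1) * (‖z‖ / r) ^ n) atTop (𝓝 0) := by
    simpa using (tendsto_pow_atTop_nhds_zero_of_lt_one (by positivity)
      ((div_lt_one hr).2 hz')).const_mul (M + 1)
  exact tendsto_nhds_unique (hg.tendsto_at hz) (squeeze_zero_norm' hbound hlim)

/-! ### Identification of the limit -/

section Main

variable {a b c : ℂ} {F₀ F₁ : ℂ → ℂ}

lemma continuation_mul_sub (hc : ∀ n : ℕ, c ≠ -(n : ℂ)) (hF₀ : IsHypContinuation a b c F₀)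
    (hF₁ : IsHypContinuation (a + 1) b (c + 1) F₁) {ω : ℂ} (hω : ω ∈ Metric.ball (0 : ℂ) 1)
    (n : ℕ) :
    F₀ ω * recSeq (fun k => coeff a b c k * ω) 0 1 n -
      F₁ ω * recSeq (fun k => coeff a b c k * ω) 1 1 n =
      -((∏ i ∈ Finset.range n, coeff a b c (i + 1)) * ω ^ n * chainFun a b c (n + 1) ω) := by
  have h := mul_recSeq_sub (fun k => coeff a b c k * ω) (F := fun n => chainFun a b c n ω)
    (chainFun_contiguous a b hc hω) n
  rw [chainFun_zero, chainFun_one, Finset.prod_mul_distrib, Finset.prod_const,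
    Finset.card_range] at h
  rw [hF₀.2 ω hω, hF₁.2 ω hω, h]

lemma continuation_zero_ne_zero (hF₀ : IsHypContinuation a b c F₀) : F₀ 0 ≠ 0 := by
  rw [hF₀.2 0 (by simp), ordinaryHypergeometric_zero]
  exact one_ne_zero

lemma eqOn_of_eventuallyEq {U : Set ℂ} (hU : IsPreconnected U) (hUc : U ⊆ cutPlane)
    (h0 : (0 : ℂ) ∈ U) (hF₀ : AnalyticOnNhd ℂ F₀ cutPlane) (hF₁ : AnalyticOnNhd ℂ F₁ cutPlane)
    {P Q : ℂ → ℂ} (hP : AnalyticOnNhd ℂ P U) (hQ : AnalyticOnNhd ℂ Q U)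
    (h : ∀ᶠ z in 𝓝 0, F₁ z * Q z = F₀ z * P z) : ∀ z ∈ U, F₁ z * Q z = F₀ z * P z :=
  ((hF₁.mono hUc).mul hQ).eqOn_of_preconnected_of_eventuallyEq ((hF₀.mono hUc).mul hP) hU h0 h

/-- On the exhausting domains, the approximants are ratios of uniformly convergent holomorphic
functions. -/
def HasUniformRatio (a b c : ℂ) (F₀ F₁ : ℂ → ℂ) (U : Set ℂ) : Prop :=
  ∃ (p q : ℕ → ℂ → ℂ) (P Q : ℂ → ℂ), AnalyticOnNhd ℂ P U ∧ AnalyticOnNhd ℂ Q U ∧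
    (∀ z ∈ U, P z ≠ 0 ∨ Q z ≠ 0) ∧ (∀ z ∈ U, F₁ z * Q z = F₀ z * P z) ∧
    TendstoUniformlyOn p P atTop U ∧ TendstoUniformlyOn q Q atTop U ∧
    ∀ᶠ n in atTop, ∀ z ∈ U, (approximant a b c n).num.eval z * q n z =
      p n z * (approximant a b c n).denom.eval z

lemma hasUniformRatio_of_coeff_ne_zero (hc : ∀ n : ℕ, c ≠ -(n : ℂ))
    (hF₀ : IsHypContinuation a b c F₀) (hF₁ : IsHypContinuation (a + 1) b (c + 1) F₁)
    (hne : ∀ n, coeff a b c (n + 1) ≠ 0) {r : ℝ} (hr0 : 0 < r) (hr1 : r < 1) :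
    HasUniformRatio a b c F₀ F₁ (cutDisk r) := by
  obtain ⟨N, hD, hlim⟩ := exists_uniform_limits (tendsto_coeff a b c) hr0 hr1
  obtain ⟨P, hP⟩ := hlim 0 1
  obtain ⟨Q, hQ⟩ := hlim 1 1
  set A : ℂ → ℕ → ℂ := fun ω => recSeq (fun k => coeff a b c k * ω) 0 1 with hA
  set B : ℂ → ℕ → ℂ := fun ω => recSeq (fun k => coeff a b c k * ω) 1 1 with hB
  set D : ℂ → ℕ → ℂ := fun ω => recSeq (fun k => coeff a b c (N + k) * ω) 1 1 with hDdef
  have hU := isOpen_cutDisk hr1.le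
  have hUc := cutDisk_subset_cutPlane hr1.le
  have h0U := zero_mem_cutDisk hr0
  have hdiff : ∀ x₀ n, DifferentiableOn ℂ (fun ω => recSeq (fun k => coeff a b c k * ω) x₀ 1
      (N + n) / D ω n) (cutDisk r) := fun x₀ n =>
    (differentiable_recSeq _ _ _ _).differentiableOn.fun_div
      (differentiable_recSeq (fun k => coeff a b c (N + k)) 1 1 n).differentiableOn (hD n)
  have hPan : AnalyticOnNhd ℂ P (cutDisk r) :=
    (hP.tendstoLocallyUniformlyOn.differentiableOn (Eventually.of_forall (hdiff 0)) hU).analyticOnNhd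
      hU
  have hQan : AnalyticOnNhd ℂ Q (cutDisk r) :=
    (hQ.tendstoLocallyUniformlyOn.differentiableOn (Eventually.of_forall (hdiff 1)) hU).analyticOnNhd
      hU
  -- Only a small closed ball is used: compactness bounds `F₀`, `F₁`, `P`, `Q`, so products converge
  -- uniformly, and the power series are available there.
  have hrel : ∀ᶠ z in 𝓝 0, F₁ z * Q z = F₀ z * P z := by
    obtain ⟨ε, hε, hball⟩ := Metric.nhds_basis_closedBall.mem_iff.1
      ((hU.inter Metric.isOpen_ball).mem_nhds
        (show (0 : ℂ) ∈ cutDisk r ∩ Metric.ball 0 1 from ⟨h0U, by simp⟩))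
    have hbU : Metric.closedBall (0 : ℂ) ε ⊆ cutDisk r := fun z hz => (hball hz).1
    have hb1 : Metric.closedBall (0 : ℂ) ε ⊆ Metric.ball 0 1 := fun z hz => (hball hz).2
    have hconst : ∀ F : ℂ → ℂ, TendstoLocallyUniformlyOn (fun _ : ℕ => F) F atTop
        (Metric.closedBall 0 ε) := fun F u hu x _ =>
      ⟨Set.univ, univ_mem, Eventually.of_forall fun _ _ _ => refl_mem_uniformity hu⟩
    have hF₀c := hF₀.1.continuousOn.mono (hbU.trans hUc)
    have hF₁c := hF₁.1.continuousOn.mono (hbU.trans hUc)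
    have hPc := hPan.continuousOn.mono hbU
    have hQc := hQan.continuousOn.mono hbU
    have hunif := (tendstoLocallyUniformlyOn_iff_tendstoUniformlyOn_of_compact
      (isCompact_closedBall (0 : ℂ) ε)).1
      (((hconst F₀).mul₀ (hP.mono hbU).tendstoLocallyUniformlyOn hF₀c hPc).sub
        ((hconst F₁).mul₀ (hQ.mono hbU).tendstoLocallyUniformlyOn hF₁c hQc))
    obtain ⟨M, hM⟩ := (isCompact_closedBall (0 : ℂ) ε).exists_bound_of_continuousOn
      ((hF₀c.mul hPc).sub (hF₁c.mul hQc))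
    filter_upwards [Metric.ball_mem_nhds (0 : ℂ) hε] with z hz
    have := limit_eq_zero_of_pow_mul (hunif.mono Metric.ball_subset_closedBall)
      (fun z hz => hM z (Metric.ball_subset_closedBall hz)) (fun n => ?_) hz
    · simp only [Pi.sub_apply, Pi.mul_apply] at this
      linear_combination -this
    -- The error carries `z ^ (N + n)`; the part `z ^ N` goes into the holomorphic cofactor.
    · refine ⟨fun z => -((∏ i ∈ Finset.range (N + n), coeff a b c (i + 1)) * z ^ N *
        chainFun a b c (N + n + 1) z) / D z n, ?_, fun z hz => ?_⟩
      · have hch : DifferentiableOn ℂ (chainFun a b c (N + n + 1)) (Metric.ball 0 ε) :=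
          (differentiableOn_hyp _ _ (add_natCast_ne_neg hc (N + n + 1))).mono
            (Metric.ball_subset_closedBall.trans hb1)
        refine DifferentiableOn.fun_div ?_
          (differentiable_recSeq (fun k => coeff a b c (N + k)) 1 1 n).differentiableOn
          fun z hz => hD n z (hbU (Metric.ball_subset_closedBall hz))
        fun_prop
      · have hz' := Metric.ball_subset_closedBall hz
        have h := continuation_mul_sub hc hF₀ hF₁ (hb1 hz') (N + n)
        simp only [Pi.sub_apply, Pi.mul_apply]
        rw [← mul_div_assoc, ← mul_div_assoc, ← sub_div, h, ← mul_div_assoc]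
        congr 1
        ring
  -- Reindexing by `n - N` aligns the sequences with the approximants; the truncated values for `n <
  -- N` do not matter.
  refine ⟨fun n ω => A ω (N + (n - N)) / D ω (n - N), fun n ω => B ω (N + (n - N)) / D ω (n - N),
    P, Q, hPan, hQan, fun ω hω => ?_, ?_, ?_, ?_, ?_⟩
  · exact limit_ne_zero hne N (fun n => hD n ω hω) (hP.tendsto_at hω) (hQ.tendsto_at hω)
  · exact eqOn_of_eventuallyEq (isPreconnected_cutDisk hr1.le) hUc h0U hF₀.1 hF₁.1 hPan hQan hrel
  · exact fun u hu => (tendsto_sub_atTop_nat N).eventually (hP u hu)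
  · exact fun u hu => (tendsto_sub_atTop_nat N).eventually (hQ u hu)
  · filter_upwards [eventually_ge_atTop N] with n hn z hz
    have h := congrArg (Polynomial.eval z) (approximant_num_mul a b c n)
    rw [Polynomial.eval_mul, Polynomial.eval_mul, numPoly_eval, denPoly_eval] at h
    rw [Nat.add_sub_cancel' hn, ← mul_div_assoc, h, div_mul_eq_mul_div]

/-- The continued fraction terminates at a vanishing coefficient. -/
lemma numPoly_mul_denPoly_of_coeff_eq_zero {m : ℕ} (hm : coeff a b c (m + 1) = 0) (k : ℕ) :
    numPoly a b c (m + 1 + k) * denPoly a b c (m + 1) =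
      numPoly a b c (m + 1) * denPoly a b c (m + 1 + k) := by
  set e : ℕ → Polynomial ℂ := fun n => Polynomial.C (coeff a b c n) * Polynomial.X with he
  -- The cross difference solves the shifted recurrence. It vanishes at `k = 0` trivially and at `k
  -- = 1` because its Casoratian contains the zero coefficient.
  have hz := recSeq_ext (fun k => e (m + 1 + k))
    (x := fun k => numPoly a b c (m + 1 + k) * denPoly a b c (m + 1) -
      numPoly a b c (m + 1) * denPoly a b c (m + 1 + k)) (y := fun _ => 0)
    (fun n => by
      simp only [numPoly, denPoly, recSeq_shift]
      ring) (fun n => by simp) (by simp [mul_comm]) (by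
      have h := casoratian e (recSeq_add_two e 0 1) (recSeq_add_two e 1 1) (m + 1)
      rw [Finset.prod_range_succ] at h
      simpa [he, hm, numPoly, denPoly] using h) k
  exact sub_eq_zero.1 hz

lemma hasUniformRatio_of_coeff_eq_zero (hc : ∀ n : ℕ, c ≠ -(n : ℂ))
    (hF₀ : IsHypContinuation a b c F₀) (hF₁ : IsHypContinuation (a + 1) b (c + 1) F₁)
    {m : ℕ} (hm : coeff a b c (m + 1) = 0) (hmin : ∀ k < m, coeff a b c (k + 1) ≠ 0)
    {r : ℝ} (hr0 : 0 < r) (hr1 : r < 1) :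
    HasUniformRatio a b c F₀ F₁ (cutDisk r) := by
  have hconst : ∀ F : ℂ → ℂ, TendstoUniformlyOn (fun _ : ℕ => F) F atTop (cutDisk r) :=
    fun F u hu => Eventually.of_forall fun _ _ _ => refl_mem_uniformity hu
  have han : ∀ p : Polynomial ℂ, AnalyticOnNhd ℂ (fun z => p.eval z) (cutDisk r) := fun p =>
    p.differentiable.differentiableOn.analyticOnNhd (isOpen_cutDisk hr1.le)
  refine ⟨fun _ z => (numPoly a b c (m + 1)).eval z, fun _ z => (denPoly a b c (m + 1)).eval z,
    fun z => (numPoly a b c (m + 1)).eval z, fun z => (denPoly a b c (m + 1)).eval z,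
    han _, han _, fun z _ => ?_, ?_, hconst _, hconst _, ?_⟩
  · by_cases hz : z = 0
    · right
      simp only [hz, denPoly_eval_zero]
      exact one_ne_zero
    · by_contra! hcon
      simp only [numPoly_eval, denPoly_eval] at hcon
      -- At index `m` the Casoratian involves only the coefficients before the first vanishing one,
      -- so it is nonzero.
      have h := casoratian (fun k => coeff a b c k * z)
        (recSeq_add_two (fun k => coeff a b c k * z) 0 1)
        (recSeq_add_two (fun k => coeff a b c k * z) 1 1) m
      rw [hcon.1, hcon.2, zero_mul, mul_zero, sub_zero, eq_comm, mul_eq_zero] at h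
      refine h.elim (Finset.prod_ne_zero_iff.2 fun i hi =>
        mul_ne_zero (hmin i (Finset.mem_range.1 hi)) hz) ?_
      simp [recSeq]
  · refine eqOn_of_eventuallyEq (isPreconnected_cutDisk hr1.le) (cutDisk_subset_cutPlane hr1.le)
      (zero_mem_cutDisk hr0) hF₀.1 hF₁.1 (han _) (han _) ?_
    filter_upwards [Metric.ball_mem_nhds (0 : ℂ) one_pos] with z hz
    -- The error term contains the vanishing coefficient, so the relation is exact.
    have h := continuation_mul_sub hc hF₀ hF₁ hz (m + 1)
    rw [Finset.prod_range_succ, hm] at h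
    rw [numPoly_eval, denPoly_eval]
    linear_combination -h
  · filter_upwards [eventually_ge_atTop (m + 1)] with n hn z _
    obtain ⟨k, rfl⟩ := Nat.exists_eq_add_of_le hn
    have h1 := approximant_num_mul a b c (m + 1 + k)
    have h2 := numPoly_mul_denPoly_of_coeff_eq_zero hm k
    have h3 : (approximant a b c (m + 1 + k)).num * denPoly a b c (m + 1) =
        numPoly a b c (m + 1) * (approximant a b c (m + 1 + k)).denom := by
      refine mul_right_cancel₀ (denPoly_ne_zero a b c (m + 1 + k)) ?_
      linear_combination denPoly a b c (m + 1) * h1 +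
        (approximant a b c (m + 1 + k)).denom * h2
    simpa using congrArg (Polynomial.eval z) h3

lemma hasUniformRatio (hc : ∀ n : ℕ, c ≠ -(n : ℂ))
    (hF₀ : IsHypContinuation a b c F₀) (hF₁ : IsHypContinuation (a + 1) b (c + 1) F₁)
    {r : ℝ} (hr0 : 0 < r) (hr1 : r < 1) : HasUniformRatio a b c F₀ F₁ (cutDisk r) := by
  classical
  by_cases h : ∃ m, coeff a b c (m + 1) = 0
  · exact hasUniformRatio_of_coeff_eq_zero hc hF₀ hF₁ (Nat.find_spec h)
      (fun k hk => Nat.find_min h hk) hr0 hr1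
  · push Not at h
    exact hasUniformRatio_of_coeff_ne_zero hc hF₀ hF₁ h hr0 hr1

theorem convergence_on_cutDisk (hc : ∀ n : ℕ, c ≠ -(n : ℂ))
    (hF₀ : IsHypContinuation a b c F₀) (hF₁ : IsHypContinuation (a + 1) b (c + 1) F₁)
    {r : ℝ} (hr0 : 0 < r) (hr1 : r < 1) :
    (∀ ω ∈ cutDisk r, Tendsto (fun n => ratValue (approximant a b c n) ω) atTop
      (𝓝 (meroValue (meroRatio F₁ F₀) ω))) ∧
    ∀ K ⊆ cutDisk r, IsCompact K → (∀ ω ∈ K, meroValue (meroRatio F₁ F₀) ω ≠ OnePoint.infty) →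
      (∀ᶠ n in atTop, ∀ ω ∈ K, (approximant a b c n).denom.eval ω ≠ 0) ∧
      TendstoUniformlyOn (fun n ω => (approximant a b c n).eval (RingHom.id ℂ) ω)
        (meroRatio F₁ F₀) atTop K := by
  obtain ⟨p, q, P, Q, hP, hQ, hPQ, hrel, hp, hq, hR⟩ := hasUniformRatio hc hF₀ hF₁ hr0 hr1
  exact convergence_of_uniform_limits hF₀.1 hF₁.1 (continuation_zero_ne_zero hF₀)
    (isOpen_cutDisk hr1.le) (cutDisk_subset_cutPlane hr1.le) hP hQ hPQ hrel hp hq hR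

end Main

end GaussCF

end

theorem mainTheorem8 (a b c : ℂ) (hc : ∀ n : ℕ, c ≠ -(n : ℂ)) :
    -- (i) correspondence
    GaussCF.CorrespondsTo (GaussCF.approximant a b c)
      ((GaussCF.hypSeries (a + 1) b (c + 1) : LaurentSeries ℂ) /
        (GaussCF.hypSeries a b c : LaurentSeries ℂ)) ∧
    -- both hypergeometric functions continue analytically to the cut plane
    (∃ F₀ : ℂ → ℂ, GaussCF.IsHypContinuation a b c F₀) ∧
    (∃ F₁ : ℂ → ℂ, GaussCF.IsHypContinuation (a + 1) b (c + 1) F₁) ∧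
    -- (ii) convergence to their quotient
    ∀ F₀ F₁ : ℂ → ℂ, GaussCF.IsHypContinuation a b c F₀ →
      GaussCF.IsHypContinuation (a + 1) b (c + 1) F₁ →
      MeromorphicOn (GaussCF.meroRatio F₁ F₀) GaussCF.cutPlane ∧
      (∀ ω ∈ GaussCF.cutPlane,
        Tendsto (fun n => GaussCF.ratValue (GaussCF.approximant a b c n) ω) atTop
          (𝓝 (GaussCF.meroValue (GaussCF.meroRatio F₁ F₀) ω))) ∧
      ∀ K : Set ℂ, IsCompact K →
        K ⊆ {ω ∈ GaussCF.cutPlane |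
          GaussCF.meroValue (GaussCF.meroRatio F₁ F₀) ω ≠ OnePoint.infty} →
        (∀ᶠ n in atTop, ∀ ω ∈ K, (GaussCF.approximant a b c n).denom.eval ω ≠ 0) ∧
        TendstoUniformlyOn
          (fun n ω => (GaussCF.approximant a b c n).eval (RingHom.id ℂ) ω)
          (GaussCF.meroRatio F₁ F₀) atTop K := by
  refine ⟨GaussCF.approximant_correspondsTo a b hc, GaussCF.exists_continuation a b hc,
    GaussCF.exists_continuation _ _ (by simpa using GaussCF.add_natCast_ne_neg hc 1),
    fun F₀ F₁ hF₀ hF₁ => ?_⟩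
  refine ⟨fun ω hω => (meromorphicNFOn_toMeromorphicNFOn _ _ hω).meromorphicAt, fun ω hω => ?_,
    fun K hK hKsub => ?_⟩
  · obtain ⟨r, hr0, hr1, hr⟩ := GaussCF.exists_subset_cutDisk (isCompact_singleton (x := ω))
      (by simpa using hω)
    exact (GaussCF.convergence_on_cutDisk hc hF₀ hF₁ hr0 hr1).1 ω (hr rfl)
  · obtain ⟨r, hr0, hr1, hr⟩ := GaussCF.exists_subset_cutDisk hK fun ω hω => (hKsub hω).1
    exact (GaussCF.convergence_on_cutDisk hc hF₀ hF₁ hr0 hr1).2 K hr hK fun ω hω => (hKsub hω).2
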